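/- A closed curve $L$ in $\mathbb{R}^3$ is a finite family of continuous maps $L_i\colon S^1\to\mathbb{R}^3$ (its components, which may intersect themselves). $L$ is a link if different components are disjoint, and it is rectifiable if its length $\mathrm{Len}(L)$ (the sum over the components of the supremal length of inscribed polygons) is finite. The link-thickness $\mathrm{LThi}(L)$ is the minimum distance between points on different components of $L$. A smooth vector field $\xi$ along a rectifiable $L$ is a continuous map from the domain of $L$ to $\mathbb{R}^3$ which on each component is a $C^\infty$ function of arclength. Write $$\delta_\xi\mathrm{Len}(L)=\frac{d}{dt}\Big|_{t=0}\mathrm{Len}(L+t\xi),\qquad \delta^+_\xi\mathrm{LThi}(L)=\frac{d}{dt}\Big|_{t=0^+}\mathrm{LThi}(L+t\xi).$$ A rectifiable link $L$ is strongly critical for link-ropelength if there is $\varepsilon>0$ such that $\delta^+_\xi\mathrm{LThi}(L)\le-\varepsilon$ for every smooth vector field $\xi$ along $L$ with $\delta_\xi\mathrm{Len}(L)=-1$. Proposition. Let $L$ be a rectifiable link that is strongly critical for link-ropelength. Then $L$ is $C^1$, that is, the arclength parametrization of each component is continuously differentiable on the whole circle; and $L$ is FTC, that is, it has finite total curvature: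 the total curvatures (sums of the exterior angles) of the closed polygons inscribed in the components of $L$ are bounded. -/

import Mathlib

open scoped ContDiff

namespace LinkRopelength

/-- Euclidean three-space. -/
abbrev E3 : Type := EuclideanSpace ℝ (Fin 3)

/-- A parametrized closed curve with a single component: a continuous map `S¹ = ℝ / ℤ → ℝ³`
(self-intersections are allowed). -/
abbrev Loop : Type := C(UnitAddCircle, E3)

/-- The `1`-periodic map `ℝ → ℝ³` that a loop induces. -/
def Loop.lift (γ : Loop) : ℝ → E3 := fun t => γ (t : UnitAddCircle)

/-- The length of a loop: the supremum of the lengths of the inscribed polygons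
(possibly infinite). -/
noncomputable def Loop.length (γ : Loop) : ENNReal :=
  eVariationOn γ.lift (Set.Icc 0 1)

/-- The (signed) arclength of a loop from the base point `0` to the parameter `t`.
If the loop is rectifiable of length `ℓ`, then `arclength (t + 1) = arclength t + ℓ`. -/
noncomputable def Loop.arclength (γ : Loop) : ℝ → ℝ :=
  variationOnFromTo γ.lift Set.univ 0

/-- The arclength parametrization `g` of a rectifiable loop, as a map on `ℝ`, that is, with
`γ.lift t = g (γ.arclength t)`. It is periodic, with period the length of the loop. -/
noncomputable def Loop.arclengthParam (γ : Loop) : ℝ → E3 :=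
  naturalParameterization γ.lift Set.univ 0

/-- A closed polygon inscribed in a loop, with `n` vertices `γ (t 0), …, γ (t (n - 1))` in their
order along the loop, and with nondegenerate edges. The vertices are listed cyclically:
going on by `n` indices means going around the circle `ℝ / ℤ` once. -/
structure Loop.InscribedPolygon (γ : Loop) where
  n : ℕ
  t : ℕ → ℝ
  mono : Monotone t
  periodic : ∀ k, t (k + n) = t k + 1
  edge_ne : ∀ k, γ.lift (t (k + 1)) ≠ γ.lift (t k)

/-- The `k`-th edge vector of an inscribed polygon. -/
def Loop.InscribedPolygon.edge {γ : Loop} (P : γ.InscribedPolygon) (k : ℕ) : E3 :=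
  γ.lift (P.t (k + 1)) - γ.lift (P.t k)

/-- The total curvature of a closed polygon: the sum of its exterior (turning) angles,
i.e. of the angles between consecutive edge vectors. -/
noncomputable def Loop.InscribedPolygon.totalCurvature {γ : Loop} (P : γ.InscribedPolygon) : ℝ :=
  ∑ k ∈ Finset.range P.n, InnerProductGeometry.angle (P.edge k) (P.edge (k + 1))

/-- The total curvature of a loop: the supremal total curvature of inscribed polygons. -/
noncomputable def Loop.totalCurvature (γ : Loop) : ENNReal :=
  ⨆ P : γ.InscribedPolygon, ENNReal.ofReal P.totalCurvature

/-- A parametrized closed curve in `ℝ³`, with components indexed by `ι`. Vector fields along such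
a curve, being continuous maps from its domain to `ℝ³`, are elements of the same space. -/
abbrev ClosedCurve (ι : Type*) : Type _ := ι → Loop

variable {ι : Type*}

/-- A link is a closed curve whose components are pairwise disjoint. -/
def ClosedCurve.IsLink (L : ClosedCurve ι) : Prop :=
  ∀ i j, i ≠ j → Disjoint (Set.range (L i)) (Set.range (L j))

/-- All components have finite length. -/
def ClosedCurve.IsRectifiable (L : ClosedCurve ι) : Prop :=
  ∀ i, (L i).length ≠ ⊤

/-- The total length of a closed curve (only used where all the components have finite length). -/
noncomputable def ClosedCurve.length [Fintype ι] (L : ClosedCurve ι) : ℝ :=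
  ∑ i, (L i).length.toReal

/-- The link-thickness: the minimal distance between points on different components. -/
noncomputable def ClosedCurve.linkThickness (L : ClosedCurve ι) : ℝ :=
  sInf {d : ℝ | ∃ i j, i ≠ j ∧ ∃ x y : UnitAddCircle, d = dist (L i x) (L j y)}

/-- The vector field `ξ` along `L` is smooth, i.e. a smooth function of arclength
on each component. (The function `Ξ` of arclength is then automatically periodic.) -/
def ClosedCurve.IsSmoothField (L ξ : ClosedCurve ι) : Prop :=
  ∀ i, ∃ Ξ : ℝ → E3, ContDiff ℝ ∞ Ξ ∧
    ∀ t : ℝ, ξ i (t : UnitAddCircle) = Ξ ((L i).arclength t)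

/-- The first variation `δ_ξ Len(L)` of length: the derivative at `t = 0` of the length
of the deformation `L + t ξ`. -/
noncomputable def ClosedCurve.firstVariationLength [Fintype ι] (L ξ : ClosedCurve ι) : ℝ :=
  deriv (fun t : ℝ => ClosedCurve.length (L + t • ξ)) 0

/-- The one-sided first variation `δ⁺_ξ` of link-thickness: the right derivative at `t = 0`
of the link-thickness of the deformation `L + t ξ`. -/
noncomputable def ClosedCurve.firstVariationThickness (L ξ : ClosedCurve ι) : ℝ :=
  derivWithin (fun t : ℝ => ClosedCurve.linkThickness (L + t • ξ)) (Set.Ici 0) 0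

/-- Strong criticality for link-ropelength. Both values below are nonzero, so that
neither can be a default value of `deriv` or `derivWithin` at a function without derivative. -/
def ClosedCurve.IsStronglyCritical [Fintype ι] (L : ClosedCurve ι) : Prop :=
  ∃ ε : ℝ, 0 < ε ∧ ∀ ξ : ClosedCurve ι, L.IsSmoothField ξ →
    L.firstVariationLength ξ = -1 → L.firstVariationThickness ξ ≤ -ε

/-- A (rectifiable) closed curve is `C¹` if the arclength parametrizations
of its components are. -/
def ClosedCurve.IsC1 (L : ClosedCurve ι) : Prop :=
  ∀ i, ContDiff ℝ 1 (L i).arclengthParam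

/-- Finite total curvature. -/
def ClosedCurve.IsFTC [Fintype ι] (L : ClosedCurve ι) : Prop :=
  ∑ i, (L i).totalCurvature < ⊤

end LinkRopelength

/-! Let `g` be the arclength parametrization of a nonconstant component and `θ` the link-thickness.
The first variation of length along `Ξ` is `∫ ⟪g', Ξ'⟫`. If it equals `-S < 0`, rescaling the field
and applying strong criticality makes the thickness decrease at a rate of at least `ε * S`. A
compactness argument then yields a strut, a shortest segment from some `g σ` to a point `y` of
another component, with `⟪g σ - y, Ξ σ⟫ ≤ -θ * ε * S` (`exists_strut_of_integral_neg`).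

Since `‖g σ - y‖ = θ`, Cauchy–Schwarz gives `S ≤ sup ‖Ξ‖ / ε`: the distributional derivative of `g'`
is locally a measure of mass at most `1 / ε`. Concretely, smoothed step functions as test fields
bound the variation of mollifications of `g'`, and lower semicontinuity passes the bound to `g'`
(`eVariationOn_deriv_le`). Hence `g'` has one-sided limits `T₁`, `T₂` everywhere, taken along almost
every parameter.

A corner `T₁ ≠ T₂` is impossible. Fields concentrated near it, pointing along `T₂ - T₁`, give struts
that accumulate at a strut from the corner to some `y` with `⟪g x - y, T₂ - T₁⟫ < 0`. But `x`
minimizes the distance to `y`, and the one-sided first-order conditions give the opposite sign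
(`leftTangent_eq_rightTangent`). So `g` is `C¹`, and the exterior angles of an inscribed polygon are
controlled by the variation of `g'` over one period (`Loop.totalCurvature_lt_top`). -/

namespace LinkRopelength

open Set Filter Topology MeasureTheory
open scoped RealInnerProductSpace

/-! ### Functions of locally bounded variation -/

section BoundedVariation

variable {F : Type*} [PseudoMetricSpace F]

theorem boundedVariationOn_Icc_append {f : ℝ → F} {a b c : ℝ}
    (h₁ : BoundedVariationOn f (Icc a b)) (h₂ : BoundedVariationOn f (Icc b c)) :
    BoundedVariationOn f (Icc a c) := by
  rcases le_total a b with hab | hab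
  · rcases le_total b c with hbc | hbc
    · have := eVariationOn.Icc_add_Icc f (s := univ) hab hbc (mem_univ b)
      simp only [univ_inter] at this
      rw [BoundedVariationOn, ← this]
      exact ENNReal.add_ne_top.2 ⟨h₁, h₂⟩
    · exact h₁.mono (Icc_subset_Icc_right hbc)
  · exact h₂.mono (Icc_subset_Icc_left hab)

theorem locallyBoundedVariationOn_of_forall_Icc {f : ℝ → F} {d : ℝ} (hd : 0 < d)
    (h : ∀ x, BoundedVariationOn f (Icc x (x + d))) : LocallyBoundedVariationOn f univ := by
  have key : ∀ (n : ℕ) (x : ℝ), BoundedVariationOn f (Icc x (x + n * d)) := by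
    intro n
    induction n with
    | zero => intro x; simp [BoundedVariationOn.of_subsingleton]
    | succ n ih =>
      intro x
      refine (boundedVariationOn_Icc_append (ih x) (h _)).mono (Icc_subset_Icc_right ?_)
      push_cast
      linarith
  intro x y _ _
  obtain ⟨n, hn⟩ := exists_nat_ge ((y - x) / d)
  rw [div_le_iff₀ hd] at hn
  exact (key n x).mono (by rw [univ_inter]; exact Icc_subset_Icc_right (by linarith))

theorem continuous_variationOnFromTo {f : ℝ → F} (hf : LocallyBoundedVariationOn f univ)
    (hc : Continuous f) (a : ℝ) : Continuous (variationOnFromTo f univ a) := by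
  rw [continuous_iff_continuousAt]
  intro b
  rw [continuousAt_iff_continuous_left'_right']
  constructor
  · have := variationOnFromTo.tendsto_left (l := f b) (mem_univ a) (mem_univ b) hf
      (hc.continuousAt.tendsto.mono_left nhdsWithin_le_nhds)
    simpa [ContinuousWithinAt] using this
  · have := variationOnFromTo.tendsto_right (l := f b) (mem_univ a) (mem_univ b) hf
      (hc.continuousAt.tendsto.mono_left nhdsWithin_le_nhds)
    simpa [ContinuousWithinAt] using this

theorem eVariationOn_Icc_add_period {f : ℝ → F} {p : ℝ} (hp : Function.Periodic f p) (a b : ℝ) :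
    eVariationOn f (Icc (a + p) (b + p)) = eVariationOn f (Icc a b) := by
  have h := eVariationOn.comp_eq_of_monotoneOn f (t := Icc a b) (fun x => x + p)
    (fun x _ y _ hxy => by simpa using hxy)
  rw [image_add_const_Icc] at h
  rw [← h]
  congr 1
  ext x
  exact hp x

theorem variationOnFromTo_add_period {f : ℝ → F} {p : ℝ} (hp : Function.Periodic f p) (a b : ℝ) :
    variationOnFromTo f univ (a + p) (b + p) = variationOnFromTo f univ a b := by
  simp only [variationOnFromTo, univ_inter, eVariationOn_Icc_add_period hp, add_le_add_iff_right]

theorem variationOnFromTo_period {f : ℝ → F} {p : ℝ} (hf : LocallyBoundedVariationOn f univ)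
    (hp : Function.Periodic f p) (a t : ℝ) :
    variationOnFromTo f univ a (t + p) =
      variationOnFromTo f univ a t + variationOnFromTo f univ a (a + p) := by
  rw [← variationOnFromTo.add hf (mem_univ a) (mem_univ (a + p)) (mem_univ (t + p)),
    variationOnFromTo_add_period hp, add_comm]

theorem dist_le_variationOnFromTo_sub {f : ℝ → F} (hf : LocallyBoundedVariationOn f univ)
    (a : ℝ) {x y : ℝ} (hxy : x ≤ y) :
    dist (f x) (f y) ≤ variationOnFromTo f univ a y - variationOnFromTo f univ a x := by
  rw [variationOnFromTo.sub_right hf (mem_univ _) (mem_univ _) (mem_univ _),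
    variationOnFromTo.eq_of_le f univ hxy, dist_edist]
  exact ENNReal.toReal_mono (hf x y trivial trivial)
    (eVariationOn.edist_le f ⟨trivial, le_rfl, hxy⟩ ⟨trivial, hxy, le_rfl⟩)

/-- The hypothesis forces `H` to be monotone, so its own variation is `H b - H a`. In applications
`H` is a primitive of a bound for the speed. -/
theorem eVariationOn_Icc_le_of_dist_le {f : ℝ → F} {H : ℝ → ℝ} {a b : ℝ} (hab : a ≤ b)
    (h : ∀ x ∈ Icc a b, ∀ y ∈ Icc a b, x ≤ y → dist (f x) (f y) ≤ H y - H x) :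
    eVariationOn f (Icc a b) ≤ ENNReal.ofReal (H b - H a) := by
  have hmono : MonotoneOn H (Icc a b) := fun x hx y hy hxy => by
    linarith [h x hx y hy hxy, dist_nonneg (x := f x) (y := f y)]
  have hH := (hmono.eVariationOn_eq (left_mem_Icc.2 hab) (right_mem_Icc.2 hab)).le
  rw [inter_self] at hH
  refine le_trans ?_ hH
  refine iSup_le fun p => ?_
  refine le_trans (Finset.sum_le_sum fun k _ => ?_) (eVariationOn.sum_le p.2.2.1 p.2.2.2 (n := p.1))
  have hk := p.2.2.1 (Nat.le_succ k)
  have := h _ (p.2.2.2 k) _ (p.2.2.2 (k + 1)) hk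
  rw [edist_dist, edist_dist]
  refine ENNReal.ofReal_le_ofReal ?_
  rw [dist_comm]
  refine this.trans ?_
  rw [Real.dist_eq]
  exact le_abs_self _

end BoundedVariation

/-! ### Arclength parametrization of a loop -/

namespace Loop

variable {γ : Loop}

theorem continuous_lift (γ : Loop) : Continuous γ.lift :=
  γ.continuous.comp (AddCircle.continuous_mk' 1)

theorem lift_periodic (γ : Loop) : Function.Periodic γ.lift 1 := fun t => by
  simp [Loop.lift]

theorem locallyBoundedVariationOn_lift (h : γ.length ≠ ⊤) :
    LocallyBoundedVariationOn γ.lift univ := by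
  have h01 : ∀ n : ℤ, BoundedVariationOn γ.lift (Icc (n : ℝ) (n + 1)) := by
    intro n
    have h1 := eVariationOn_Icc_add_period (γ.lift_periodic.int_mul n) 0 1
    simp only [mul_one, zero_add] at h1
    rw [BoundedVariationOn, add_comm (n : ℝ) 1, h1]
    exact h
  refine locallyBoundedVariationOn_of_forall_Icc one_pos fun x => ?_
  refine (boundedVariationOn_Icc_append (h01 ⌊x⌋) (by simpa using h01 (⌊x⌋ + 1))).mono ?_
  exact Icc_subset_Icc (Int.floor_le x) (by linarith [Int.lt_floor_add_one x])

/-- The length of a loop as a real number. -/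
noncomputable def len (γ : Loop) : ℝ := γ.length.toReal

theorem len_nonneg (γ : Loop) : 0 ≤ γ.len := ENNReal.toReal_nonneg

theorem arclength_zero (γ : Loop) : γ.arclength 0 = 0 := variationOnFromTo.self _ _ _

theorem arclength_one (γ : Loop) : γ.arclength 1 = γ.len := by
  rw [arclength, variationOnFromTo.eq_of_le _ _ zero_le_one, univ_inter]
  rfl

theorem arclength_add_one (h : γ.length ≠ ⊤) (t : ℝ) :
    γ.arclength (t + 1) = γ.arclength t + γ.len := by
  have := variationOnFromTo_period (locallyBoundedVariationOn_lift h) γ.lift_periodic 0 t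
  rw [zero_add] at this
  rw [← arclength_one]
  exact this

theorem continuous_arclength (h : γ.length ≠ ⊤) : Continuous γ.arclength :=
  continuous_variationOnFromTo (locallyBoundedVariationOn_lift h) γ.continuous_lift 0

theorem monotone_arclength (h : γ.length ≠ ⊤) : Monotone γ.arclength :=
  monotoneOn_univ.1 (variationOnFromTo.monotoneOn (locallyBoundedVariationOn_lift h) (mem_univ 0))

theorem arclength_natCast (h : γ.length ≠ ⊤) (n : ℕ) : γ.arclength n = n * γ.len := by
  induction n with
  | zero => simp [arclength_zero]
  | succ n ih => push_cast; rw [arclength_add_one h, ih]; ring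

theorem arclength_neg_natCast (h : γ.length ≠ ⊤) (n : ℕ) : γ.arclength (-n) = -(n * γ.len) := by
  induction n with
  | zero => simp [arclength_zero]
  | succ n ih =>
    have := arclength_add_one h (-((n + 1 : ℕ) : ℝ))
    rw [show -((n + 1 : ℕ) : ℝ) + 1 = -(n : ℝ) by push_cast; ring, ih] at this
    push_cast at this ⊢
    linarith

theorem surjective_arclength (h : γ.length ≠ ⊤) (hpos : 0 < γ.len) :
    Function.Surjective γ.arclength := by
  refine (continuous_arclength h).surjective ?_ ?_
  · refine tendsto_atTop_atTop_of_monotone (monotone_arclength h) fun b => ?_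
    obtain ⟨n, hn⟩ := exists_nat_ge (b / γ.len)
    exact ⟨n, by rw [arclength_natCast h]; rwa [div_le_iff₀ hpos] at hn⟩
  · refine tendsto_atBot_atBot_of_monotone (monotone_arclength h) fun b => ?_
    obtain ⟨n, hn⟩ := exists_nat_ge (-b / γ.len)
    refine ⟨-n, ?_⟩
    rw [arclength_neg_natCast h]
    rw [div_le_iff₀ hpos] at hn
    linarith

theorem arclengthParam_arclength (h : γ.length ≠ ⊤) (t : ℝ) :
    γ.arclengthParam (γ.arclength t) = γ.lift t :=
  edist_eq_zero.1 (edist_naturalParameterization_eq_zero (locallyBoundedVariationOn_lift h)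
    (mem_univ 0) (mem_univ t))

theorem hasUnitSpeedOn_arclengthParam (h : γ.length ≠ ⊤) (hpos : 0 < γ.len) :
    HasUnitSpeedOn γ.arclengthParam univ := by
  have := has_unit_speed_naturalParameterization γ.lift (locallyBoundedVariationOn_lift h)
    (mem_univ 0)
  rwa [image_univ, show range (variationOnFromTo γ.lift univ 0) = univ from
    (surjective_arclength h hpos).range_eq] at this

theorem eVariationOn_arclengthParam_Icc (h : γ.length ≠ ⊤) (hpos : 0 < γ.len) (x y : ℝ) :
    eVariationOn γ.arclengthParam (Icc x y) = ENNReal.ofReal (y - x) := by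
  simpa using hasUnitSpeedOn_arclengthParam h hpos (mem_univ x) (mem_univ y)

theorem lipschitzWith_arclengthParam (h : γ.length ≠ ⊤) (hpos : 0 < γ.len) :
    LipschitzWith 1 γ.arclengthParam := by
  refine LipschitzWith.of_dist_le_mul fun x y => ?_
  wlog hxy : x ≤ y
  · rw [dist_comm, dist_comm x]
    exact this h hpos y x (le_of_not_ge hxy)
  have := eVariationOn.edist_le γ.arclengthParam (left_mem_Icc.2 hxy) (right_mem_Icc.2 hxy)
  rw [eVariationOn_arclengthParam_Icc h hpos, edist_dist,
    ENNReal.ofReal_le_ofReal_iff (by linarith)] at this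
  rw [NNReal.coe_one, one_mul, dist_comm x, Real.dist_eq, abs_of_nonneg (by linarith)]
  exact this

theorem arclengthParam_periodic (h : γ.length ≠ ⊤) (hpos : 0 < γ.len) :
    Function.Periodic γ.arclengthParam γ.len := fun s => by
  obtain ⟨t, rfl⟩ := surjective_arclength h hpos s
  rw [← arclength_add_one h, arclengthParam_arclength h, arclengthParam_arclength h,
    γ.lift_periodic]

theorem lift_eq_of_len_eq_zero (h : γ.length ≠ ⊤) (h0 : γ.len = 0) (s t : ℝ) :
    γ.lift s = γ.lift t := by
  have h0' : γ.length = 0 := by simpa [len, ENNReal.toReal_eq_zero_iff, h] using h0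
  rw [length, eVariationOn.eq_zero_iff] at h0'
  obtain ⟨s', hs', hs⟩ := γ.lift_periodic.exists_mem_Ico₀ one_pos s
  obtain ⟨t', ht', ht⟩ := γ.lift_periodic.exists_mem_Ico₀ one_pos t
  rw [hs, ht]
  exact edist_eq_zero.1 (h0' s' (Ico_subset_Icc_self hs') t' (Ico_subset_Icc_self ht'))

/-- The vector field along `γ` that a continuous periodic function of arclength induces. -/
theorem exists_field (h : γ.length ≠ ⊤) {Ξ : ℝ → E3} (hc : Continuous Ξ)
    (hp : Function.Periodic Ξ γ.len) :
    ∃ ξ : Loop, ∀ t : ℝ, ξ (t : UnitAddCircle) = Ξ (γ.arclength t) := by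
  have hper : Function.Periodic (fun t => Ξ (γ.arclength t)) 1 := fun t => by
    simp only [arclength_add_one h]; exact hp _
  refine ⟨⟨hper.lift, ?_⟩, fun t => hper.lift_coe t⟩
  refine continuous_coinduced_dom.2 ?_
  exact hc.comp (continuous_arclength h)

end Loop

/-! ### First variation of length -/

section FirstVariation

variable {g : ℝ → E3}

theorem norm_deriv_le_one (hg : LipschitzWith 1 g) (x : ℝ) : ‖deriv g x‖ ≤ 1 := by
  simpa using norm_deriv_le_of_lipschitz (x₀ := x) hg

theorem locallyIntegrable_deriv (hg : LipschitzWith 1 g) : LocallyIntegrable (deriv g) volume := by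
  refine (locallyIntegrable_const (1 : ℝ)).mono (stronglyMeasurable_deriv g).aestronglyMeasurable ?_
  exact ae_of_all _ fun x => by simpa using norm_deriv_le_one hg x

theorem intervalIntegrable_deriv (hg : LipschitzWith 1 g) (a b : ℝ) :
    IntervalIntegrable (deriv g) volume a b :=
  (locallyIntegrable_deriv hg).integrableOn_isCompact isCompact_uIcc |>.intervalIntegrable

/-- Each coordinate of `g` is Lipschitz, hence absolutely continuous. -/
theorem integral_deriv_of_lipschitz (hg : LipschitzWith 1 g) (a b : ℝ) :
    ∫ x in a..b, deriv g x = g b - g a := by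
  ext i
  let p : E3 →L[ℝ] ℝ := EuclideanSpace.proj i
  have hp : LipschitzWith (‖p‖₊ * 1) (p ∘ g) := p.lipschitz.comp hg
  have h1 := (hp.lipschitzOnWith (s := uIcc a b)).absolutelyContinuousOnInterval.integral_deriv_eq_sub
  have h2 : ∫ x in a..b, deriv (p ∘ g) x = ∫ x in a..b, p (deriv g x) := by
    refine intervalIntegral.integral_congr_ae ?_
    filter_upwards [hg.ae_differentiableAt] with x hx _
    exact (p.hasFDerivAt.comp_hasDerivAt x hx.hasDerivAt).deriv
  rw [h2, p.intervalIntegral_comp_comm (intervalIntegrable_deriv hg a b)] at h1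
  simpa [p] using h1

theorem intervalIntegrable_inner_deriv (hg : LipschitzWith 1 g) {Ψ : ℝ → E3}
    (hΨ : Continuous Ψ) (a b : ℝ) :
    IntervalIntegrable (fun s => ⟪deriv g s, Ψ s⟫) volume a b := by
  refine (hΨ.norm.intervalIntegrable a b).mono_fun ?_ (ae_of_all _ fun x => ?_)
  · exact ((stronglyMeasurable_deriv g).inner hΨ.stronglyMeasurable).aestronglyMeasurable
  · simp only [norm_norm]
    exact (norm_inner_le_norm _ _).trans
      (mul_le_of_le_one_left (norm_nonneg _) (norm_deriv_le_one hg x))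

/-- From `‖v‖ ≤ (1 + ‖v‖ ^ 2) / 2` with `v = g' + t Ξ'` and `‖g'‖ ≤ 1`, the speed is at most `1 + t
⟪g', Ξ'⟫ + t ^ 2 K ^ 2 / 2`; integrate. -/
theorem eVariationOn_add_smul_le (hg : LipschitzWith 1 g) {Ξ : ℝ → E3} (hΞ : ContDiff ℝ 1 Ξ)
    {l K : ℝ} (hl : 0 ≤ l) (hK : ∀ s ∈ Icc 0 l, ‖deriv Ξ s‖ ≤ K) (t : ℝ) :
    eVariationOn (g + t • Ξ) (Icc 0 l) ≤ ENNReal.ofReal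
      (l + t * (∫ s in 0..l, ⟪deriv g s, deriv Ξ s⟫) + t ^ 2 * (K ^ 2 * l / 2)) := by
  have hd : Continuous (deriv Ξ) := hΞ.continuous_deriv le_rfl
  let q : ℝ → ℝ := fun s => t * ⟪deriv g s, deriv Ξ s⟫ + (1 + t ^ 2 * K ^ 2 / 2)
  have hi := intervalIntegrable_inner_deriv hg hd
  have hq : ∀ x y, IntervalIntegrable q volume x y := fun x y =>
    ((hi x y).const_mul t).add intervalIntegrable_const
  have key := eVariationOn_Icc_le_of_dist_le (f := g + t • Ξ) (H := fun x => ∫ s in 0..x, q s) hl ?_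
  · refine key.trans (ENNReal.ofReal_le_ofReal (le_of_eq ?_))
    simp only [q, intervalIntegral.integral_same]
    rw [intervalIntegral.integral_add ((hi 0 l).const_mul t) intervalIntegrable_const,
      intervalIntegral.integral_const_mul, intervalIntegral.integral_const, smul_eq_mul]
    ring
  · intro x hx y hy hxy
    rw [intervalIntegral.integral_interval_sub_left (hq 0 y) (hq 0 x)]
    have hΞi : IntervalIntegrable (deriv Ξ) volume x y := hd.intervalIntegrable x y
    have e : (g + t • Ξ) y - (g + t • Ξ) x = ∫ s in x..y, (deriv g s + t • deriv Ξ s) := by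
      have hΞt : IntervalIntegrable (fun s => t • deriv Ξ s) volume x y := hΞi.smul t
      rw [intervalIntegral.integral_add (intervalIntegrable_deriv hg x y) hΞt,
        integral_deriv_of_lipschitz hg, intervalIntegral.integral_smul,
        intervalIntegral.integral_deriv_eq_sub
          (fun s _ => (hΞ.differentiable one_ne_zero).differentiableAt) hΞi]
      simp only [Pi.add_apply, Pi.smul_apply, smul_sub]
      abel
    rw [dist_comm, dist_eq_norm, e]
    refine intervalIntegral.norm_integral_le_of_norm_le hxy (ae_of_all _ fun s hs => ?_) (hq x y)
    have h1 := norm_deriv_le_one hg s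
    have h2 := hK s ⟨hx.1.trans hs.1.le, hs.2.trans hy.2⟩
    have h3 := norm_add_sq_real (deriv g s) (t • deriv Ξ s)
    rw [inner_smul_right, norm_smul, mul_pow, Real.norm_eq_abs, sq_abs] at h3
    have h4 : ‖deriv g s‖ ^ 2 ≤ 1 := pow_le_one₀ (norm_nonneg _) h1
    have h5 : t ^ 2 * ‖deriv Ξ s‖ ^ 2 ≤ t ^ 2 * K ^ 2 :=
      mul_le_mul_of_nonneg_left (pow_le_pow_left₀ (norm_nonneg _) h2 2) (sq_nonneg t)
    have h6 := sq_nonneg (‖deriv g s + t • deriv Ξ s‖ - 1)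
    simp only [q]
    nlinarith

/-- Midpoint convexity of length; it converts upper bounds for length into lower ones. -/
theorem two_mul_eVariationOn_le {F : Type*} [NormedAddCommGroup F] [NormedSpace ℝ F]
    (f h : ℝ → F) (s : Set ℝ) :
    2 * eVariationOn f s ≤ eVariationOn (f + h) s + eVariationOn (f - h) s := by
  rw [eVariationOn, ENNReal.mul_iSup]
  refine iSup_le fun p => ?_
  refine le_trans ?_ (add_le_add
    (eVariationOn.sum_le (f := f + h) p.2.2.1 p.2.2.2 (n := p.1))
    (eVariationOn.sum_le (f := f - h) p.2.2.1 p.2.2.2 (n := p.1)))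
  rw [Finset.mul_sum, ← Finset.sum_add_distrib]
  refine Finset.sum_le_sum fun k _ => ?_
  generalize p.2.1 (k + 1) = y
  generalize p.2.1 k = x
  simp only [edist_dist]
  rw [← ENNReal.ofReal_add dist_nonneg dist_nonneg,
    show (2 : ENNReal) = ENNReal.ofReal 2 by simp, ← ENNReal.ofReal_mul zero_le_two]
  refine ENNReal.ofReal_le_ofReal ?_
  simp only [dist_eq_norm, Pi.add_apply, Pi.sub_apply]
  have e : (2 : ℝ) • (f y - f x) = (f y + h y - (f x + h x)) + (f y - h y - (f x - h x)) := by
    rw [two_smul]; abel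
  calc 2 * ‖f y - f x‖ = ‖(2 : ℝ) • (f y - f x)‖ := by rw [norm_smul]; simp
    _ ≤ _ := by rw [e]; exact norm_add_le _ _

theorem hasDerivAt_zero_of_abs_sub_le {F : ℝ → ℝ} {b C : ℝ}
    (h : ∀ t, |F t - F 0 - t * b| ≤ C * t ^ 2) : HasDerivAt F b 0 := by
  rw [hasDerivAt_iff_isLittleO_nhds_zero]
  have h2 : (fun t : ℝ => t ^ 2) =o[𝓝 0] fun t : ℝ => t := by
    simpa using Asymptotics.isLittleO_pow_pow (𝕜 := ℝ) one_lt_two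
  refine Asymptotics.IsBigO.trans_isLittleO (Asymptotics.IsBigO.of_bound C ?_) h2
  refine Eventually.of_forall fun t => ?_
  simpa using h t

/-- The quadratic upper bound at `-t`, together with convexity, gives a matching lower bound at `t`.
This avoids proving that `‖g'‖ = 1` almost everywhere. -/
theorem hasDerivAt_eVariationOn (hg : LipschitzWith 1 g) {Ξ : ℝ → E3} (hΞ : ContDiff ℝ 1 Ξ)
    {l : ℝ} (hl : 0 ≤ l) (hgl : eVariationOn g (Icc 0 l) = ENNReal.ofReal l) :
    HasDerivAt (fun t : ℝ => (eVariationOn (g + t • Ξ) (Icc 0 l)).toReal)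
      (∫ s in 0..l, ⟪deriv g s, deriv Ξ s⟫) 0 := by
  set b := ∫ s in 0..l, ⟪deriv g s, deriv Ξ s⟫ with hb
  obtain ⟨K, hK⟩ := (isCompact_Icc (a := 0) (b := l)).exists_bound_of_continuousOn
    (hΞ.continuous_deriv le_rfl).continuousOn
  set D := K ^ 2 * l / 2 with hD
  have upper := eVariationOn_add_smul_le hg hΞ hl hK
  have hfin : ∀ t : ℝ, eVariationOn (g + t • Ξ) (Icc 0 l) ≠ ⊤ := fun t =>
    ne_top_of_le_ne_top ENNReal.ofReal_ne_top (upper t)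
  have hconv : ∀ t : ℝ, 2 * l ≤ (eVariationOn (g + t • Ξ) (Icc 0 l)).toReal +
      (eVariationOn (g + (-t) • Ξ) (Icc 0 l)).toReal := by
    intro t
    have := two_mul_eVariationOn_le g (t • Ξ) (Icc 0 l)
    rw [sub_eq_add_neg, ← neg_smul, hgl] at this
    have := ENNReal.toReal_mono (ENNReal.add_ne_top.2 ⟨hfin t, hfin (-t)⟩) this
    rwa [ENNReal.toReal_add (hfin t) (hfin (-t)), ENNReal.toReal_mul, ENNReal.toReal_ofReal hl,
      ENNReal.toReal_ofNat] at this
  have hF0 : (eVariationOn (g + (0 : ℝ) • Ξ) (Icc 0 l)).toReal = l := by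
    rw [zero_smul, add_zero, hgl, ENNReal.toReal_ofReal hl]
  have hup : ∀ t : ℝ, (eVariationOn (g + t • Ξ) (Icc 0 l)).toReal ≤ l + t * b + t ^ 2 * D := by
    intro t
    -- `ENNReal.ofReal` truncates at zero, so the bound must be seen to be nonnegative; this follows
    -- by completing the square.
    have hnn : 0 ≤ l + t * b + t ^ 2 * D := by
      have hb1 : |b| ≤ K * l := by
        have := intervalIntegral.norm_integral_le_of_norm_le_const (a := 0) (b := l) (C := K)
          (f := fun s => ⟪deriv g s, deriv Ξ s⟫) (fun s hs => ?_)
        · simpa [abs_of_nonneg hl] using this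
        · rw [uIoc_of_le hl] at hs
          refine (norm_inner_le_norm _ _).trans ?_
          exact (mul_le_of_le_one_left (norm_nonneg _) (norm_deriv_le_one hg s)).trans
            (hK s (Ioc_subset_Icc_self hs))
      have h1 : -(|t| * (K * l)) ≤ t * b := by
        have : |t * b| ≤ |t| * (K * l) := by
          rw [abs_mul]; exact mul_le_mul_of_nonneg_left hb1 (abs_nonneg t)
        linarith [neg_abs_le (t * b)]
      have h2 : 0 ≤ l * (|t| * K - 1) ^ 2 := by positivity
      have h3 : |t| ^ 2 = t ^ 2 := sq_abs t
      have h4 : l * (|t| * K - 1) ^ 2 = t ^ 2 * K ^ 2 * l - 2 * (|t| * (K * l)) + l := by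
        rw [← h3]; ring
      rw [hD]
      linarith
    exact ENNReal.toReal_le_of_le_ofReal hnn (upper t)
  refine hasDerivAt_zero_of_abs_sub_le (C := D) fun t => ?_
  rw [hF0, abs_le]
  have h1 := hup t
  have h2 := hup (-t)
  have h3 := hconv t
  constructor <;> nlinarith

end FirstVariation

/-! ### Link-thickness and struts -/

namespace ClosedCurve

variable {ι : Type*}

theorem linkThickness_le (L : ClosedCurve ι) {i j : ι} (hij : i ≠ j) (x y : UnitAddCircle) :
    L.linkThickness ≤ dist (L i x) (L j y) :=
  csInf_le ⟨0, by rintro _ ⟨_, _, _, _, _, rfl⟩; exact dist_nonneg⟩ ⟨i, j, hij, x, y, rfl⟩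

theorem linkThickness_nonneg (L : ClosedCurve ι) : 0 ≤ L.linkThickness :=
  Real.sInf_nonneg (by rintro _ ⟨_, _, _, _, _, rfl⟩; exact dist_nonneg)

/-- The infimum is over the empty set, where `sInf` is `0`. Hence a nonzero thickness variation
forces two components to exist. -/
theorem linkThickness_of_subsingleton (h : ∀ i j : ι, i = j) (L : ClosedCurve ι) :
    L.linkThickness = 0 := by
  rw [linkThickness, ← Real.sInf_empty]
  congr 1
  ext d
  simp only [mem_ofPred_eq, mem_empty_iff_false, iff_false]
  rintro ⟨i, j, hij, -⟩
  exact hij (h i j)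

theorem exists_linkThickness_eq_dist [Finite ι] (L : ClosedCurve ι) (h : ∃ i j : ι, i ≠ j) :
    ∃ i j, i ≠ j ∧ ∃ x y, L.linkThickness = dist (L i x) (L j y) := by
  have hset : {d : ℝ | ∃ i j, i ≠ j ∧ ∃ x y : UnitAddCircle, d = dist (L i x) (L j y)} =
      ⋃ p ∈ {p : ι × ι | p.1 ≠ p.2},
        range fun z : UnitAddCircle × UnitAddCircle => dist (L p.1 z.1) (L p.2 z.2) := by
    ext d
    simp only [mem_ofPred_eq, mem_iUnion, mem_range, Prod.exists, exists_prop]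
    exact ⟨fun ⟨i, j, hij, x, y, h⟩ => ⟨i, j, hij, x, y, h.symm⟩,
      fun ⟨i, j, hij, x, y, h⟩ => ⟨i, j, hij, x, y, h.symm⟩⟩
  have hc : IsCompact {d : ℝ | ∃ i j, i ≠ j ∧ ∃ x y : UnitAddCircle, d = dist (L i x) (L j y)} := by
    rw [hset]
    refine (toFinite _).isCompact_biUnion fun p _ => isCompact_range ?_
    exact ((L p.1).continuous.comp continuous_fst).dist ((L p.2).continuous.comp continuous_snd)
  obtain ⟨i, j, hij⟩ := h
  exact hc.sInf_mem ⟨_, i, j, hij, 0, 0, rfl⟩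

theorem IsLink.linkThickness_pos [Finite ι] {L : ClosedCurve ι} (hL : L.IsLink)
    (h : ∃ i j : ι, i ≠ j) : 0 < L.linkThickness := by
  obtain ⟨i, j, hij, x, y, hd⟩ := L.exists_linkThickness_eq_dist h
  rw [hd, dist_pos]
  intro hxy
  exact disjoint_left.1 (hL i j hij) ⟨x, rfl⟩ ⟨y, hxy.symm⟩

theorem exists_ne_of_firstVariationThickness_ne_zero {L ξ : ClosedCurve ι}
    (hd : L.firstVariationThickness ξ ≠ 0) : ∃ i j : ι, i ≠ j := by
  by_contra! h
  apply hd
  simp [firstVariationThickness, linkThickness_of_subsingleton h]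

/-- If the one-sided first variation of link-thickness is not zero, then there is a strut that is
shortened at least at this rate. -/
theorem exists_strut_inner_le [Finite ι] {L ξ : ClosedCurve ι}
    (hd : L.firstVariationThickness ξ ≠ 0) :
    ∃ i j, i ≠ j ∧ ∃ x y, dist (L i x) (L j y) = L.linkThickness ∧
      ⟪L i x - L j y, ξ i x - ξ j y⟫ ≤ L.linkThickness * L.firstVariationThickness ξ := by
  have hne := exists_ne_of_firstVariationThickness_ne_zero hd
  set θ : ℝ → ℝ := fun t => linkThickness (L + t • ξ) with hθ
  set d := L.firstVariationThickness ξ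
  have hderiv : HasDerivWithinAt θ d (Ici 0) 0 :=
    (differentiableWithinAt_of_derivWithin_ne_zero hd).hasDerivWithinAt
  have hL0 : L + (0 : ℝ) • ξ = L := by
    funext k
    ext x
    simp
  have hθ0 : θ 0 = L.linkThickness := by simp only [hθ, hL0]
  -- The squared thickness is used because squared distances are quadratic polynomials in `t`.
  have hsq : Tendsto (slope (fun t => θ t ^ 2) 0) (𝓝[>] 0) (𝓝 (2 * (L.linkThickness * d))) := by
    have := hasDerivWithinAt_Ioi_iff_Ici.2 (hderiv.pow 2)
    rw [hasDerivWithinAt_iff_tendsto_slope' (by simp)] at this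
    simp only [hθ0, Nat.cast_ofNat, Nat.add_one_sub_one, pow_one] at this
    rwa [mul_assoc] at this
  -- With `ι` finite and discrete, pairs of points of the link form a compact space, so minimizing
  -- pairs `m t` converge along an ultrafilter finer than `𝓝[>] 0`.
  let : TopologicalSpace ι := ⊥
  have : DiscreteTopology ι := ⟨rfl⟩
  have hΦ : Continuous fun p : ι × UnitAddCircle => L p.1 p.2 :=
    continuous_prod_of_discrete_left.2 fun i => (L i).continuous
  have hΨ : Continuous fun p : ι × UnitAddCircle => ξ p.1 p.2 :=
    continuous_prod_of_discrete_left.2 fun i => (ξ i).continuous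
  have hmin : ∀ t : ℝ, ∃ m : (ι × UnitAddCircle) × (ι × UnitAddCircle), m.1.1 ≠ m.2.1 ∧
      θ t = dist ((L + t • ξ) m.1.1 m.1.2) ((L + t • ξ) m.2.1 m.2.2) := fun t => by
    obtain ⟨i, j, hij, x, y, h⟩ := (L + t • ξ).exists_linkThickness_eq_dist hne
    exact ⟨((i, x), (j, y)), hij, h⟩
  choose m hm hmθ using hmin
  let U : Ultrafilter ℝ := Ultrafilter.of (𝓝[>] 0)
  have hU : (U : Filter ℝ) ≤ 𝓝[>] 0 := Ultrafilter.of_le _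
  obtain ⟨m₀, hm₀⟩ : ∃ m₀, Tendsto m U (𝓝 m₀) := ⟨_, (U.map m).le_nhds_lim⟩
  have hU0 : Tendsto (fun t : ℝ => t) U (𝓝 0) := hU.trans nhdsWithin_le_nhds
  set P : (ι × UnitAddCircle) × (ι × UnitAddCircle) → E3 :=
    fun m => L m.1.1 m.1.2 - L m.2.1 m.2.2 with hP
  set Q : (ι × UnitAddCircle) × (ι × UnitAddCircle) → E3 :=
    fun m => ξ m.1.1 m.1.2 - ξ m.2.1 m.2.2 with hQ
  have hPc : Continuous P := (hΦ.comp continuous_fst).sub (hΦ.comp continuous_snd)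
  have hQc : Continuous Q := (hΨ.comp continuous_fst).sub (hΨ.comp continuous_snd)
  have hPt := (hPc.tendsto m₀).comp hm₀
  have hQt := (hQc.tendsto m₀).comp hm₀
  have hθP : ∀ t, θ t = ‖P (m t) + t • Q (m t)‖ := fun t => by
    rw [hmθ t, dist_eq_norm]
    congr 1
    simp only [hP, hQ, Pi.add_apply, Pi.smul_apply, ContinuousMap.add_apply,
      ContinuousMap.smul_apply, smul_sub]
    abel
  refine ⟨m₀.1.1, m₀.2.1, ?_, m₀.1.2, m₀.2.2, ?_, ?_⟩
  · have h1 : Tendsto (fun t => ((m t).1.1, (m t).2.1)) U (𝓝 (m₀.1.1, m₀.2.1)) :=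
      ((continuous_fst.fst.prodMk continuous_snd.fst).tendsto m₀).comp hm₀
    rw [nhds_discrete, tendsto_pure] at h1
    obtain ⟨t, ht⟩ := h1.exists
    simp only [Prod.mk.injEq] at ht
    rw [← ht.1, ← ht.2]
    exact hm t
  · have h1 : Tendsto θ U (𝓝 L.linkThickness) := by
      have := hderiv.continuousWithinAt.tendsto
      rw [hθ0] at this
      exact this.mono_left (hU.trans (nhdsWithin_mono _ Ioi_subset_Ici_self))
    have h2 : Tendsto (fun t => ‖P (m t) + t • Q (m t)‖) U (𝓝 ‖P m₀ + (0 : ℝ) • Q m₀‖) :=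
      (hPt.add (hU0.smul hQt)).norm
    rw [dist_eq_norm]
    simp only [← hθP, zero_smul, add_zero] at h2
    exact tendsto_nhds_unique h2 h1
  · have h1 : Tendsto (fun t => 2 * ⟪P (m t), Q (m t)⟫) U (𝓝 (2 * ⟪P m₀, Q m₀⟫)) :=
      (hPt.inner hQt).const_mul 2
    have h2 := le_of_tendsto_of_tendsto h1 (hsq.mono_left hU) ?_
    · linarith
    -- Here `θ t ^ 2 = ‖P‖ ^ 2 + 2 t ⟪P, Q⟫ + t ^ 2 ‖Q‖ ^ 2` at `m t`, and `‖P‖ ≥ θ 0`; drop the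
    -- last term and divide by `t`.
    filter_upwards [hU self_mem_nhdsWithin] with t ht
    have ht' : (0 : ℝ) < t := ht
    rw [slope_def_field, sub_zero, le_div_iff₀ ht', hθ0, hθP t, norm_add_sq_real,
      inner_smul_right]
    have h3 : L.linkThickness ≤ ‖P (m t)‖ := by
      rw [← dist_eq_norm]
      exact L.linkThickness_le (hm t) _ _
    have h4 := pow_le_pow_left₀ L.linkThickness_nonneg h3 2
    nlinarith [sq_nonneg ‖t • Q (m t)‖]

end ClosedCurve

theorem Loop.length_add_smul {γ ξ : Loop} (h : γ.length ≠ ⊤) {Ξ : ℝ → E3}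
    (hξ : ∀ t : ℝ, ξ (t : UnitAddCircle) = Ξ (γ.arclength t)) (t : ℝ) :
    (γ + t • ξ).length = eVariationOn (γ.arclengthParam + t • Ξ) (Icc 0 γ.len) := by
  have hlift : (γ + t • ξ).lift = (γ.arclengthParam + t • Ξ) ∘ γ.arclength := by
    funext s
    simp only [Function.comp_apply, Pi.add_apply, Pi.smul_apply, γ.arclengthParam_arclength h,
      ← hξ]
    rfl
  have himage : γ.arclength '' Icc 0 1 = Icc 0 γ.len := by
    rw [(Loop.continuous_arclength h).continuousOn.image_Icc_of_monotoneOn zero_le_one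
      ((Loop.monotone_arclength h).monotoneOn _), γ.arclength_zero, γ.arclength_one]
  rw [Loop.length, hlift, eVariationOn.comp_eq_of_monotoneOn _ _
    ((Loop.monotone_arclength h).monotoneOn _), himage]

/-! ### Varying a single component -/

namespace ClosedCurve

variable {ι : Type*}

/-- The points on the components of `L` other than `L i`. -/
def others (L : ClosedCurve ι) (i : ι) : Set E3 := ⋃ j ∈ {j | j ≠ i}, range (L j)

theorem isCompact_others [Finite ι] (L : ClosedCurve ι) (i : ι) : IsCompact (L.others i) :=
  (toFinite _).isCompact_biUnion fun j _ => isCompact_range (L j).continuous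

/-- The vector field along `L` that vanishes except on one component. -/
noncomputable def singleField [DecidableEq ι] (i : ι) (ξ : Loop) : ClosedCurve ι :=
  fun k => if k = i then ξ else 0

theorem firstVariationLength_singleField [Fintype ι] [DecidableEq ι] {L : ClosedCurve ι} {i : ι}
    (h : (L i).length ≠ ⊤) (hpos : 0 < (L i).len) {Ξ : ℝ → E3} (hΞ : ContDiff ℝ 1 Ξ) {ξ : Loop}
    (hξ : ∀ t : ℝ, ξ (t : UnitAddCircle) = Ξ ((L i).arclength t)) :
    L.firstVariationLength (singleField i ξ) =
      ∫ s in 0..(L i).len, ⟪deriv (L i).arclengthParam s, deriv Ξ s⟫ := by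
  refine HasDerivAt.deriv ?_
  have key : ∀ k ∈ Finset.univ, HasDerivAt
      (fun t : ℝ => ((L + t • singleField i ξ) k).length.toReal)
      (if k = i then ∫ s in 0..(L i).len, ⟪deriv (L i).arclengthParam s, deriv Ξ s⟫ else 0) 0 := by
    intro k _
    by_cases hk : k = i
    · subst hk
      simp only [if_pos]
      have : (fun t : ℝ => ((L + t • singleField k ξ) k).length.toReal) = fun t : ℝ =>
          (eVariationOn ((L k).arclengthParam + t • Ξ) (Icc 0 (L k).len)).toReal := by
        funext t
        rw [← Loop.length_add_smul h hξ t]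
        simp [singleField]
      rw [this]
      refine hasDerivAt_eVariationOn (Loop.lipschitzWith_arclengthParam h hpos) hΞ
        (L k).len_nonneg ?_
      rw [Loop.eVariationOn_arclengthParam_Icc h hpos, sub_zero]
    · simp only [if_neg hk]
      have : (fun t : ℝ => ((L + t • singleField i ξ) k).length.toReal) =
          fun _ => (L k).length.toReal := by
        funext t
        have h0 : L k + t • (0 : Loop) = L k := by
          ext x
          simp
        simp [singleField, hk, h0]
      rw [this]
      exact hasDerivAt_const _ _
  have := HasDerivAt.fun_sum key
  rwa [Finset.sum_ite_eq' Finset.univ i, if_pos (Finset.mem_univ i)] at this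

/-- The variational inequality for a vector field on one component of a strongly critical link:
if the field decreases length, then there is a strut that it shortens at a definite rate. -/
theorem exists_strut_of_integral_neg [Fintype ι] {L : ClosedCurve ι} (hL : L.IsLink) {ε : ℝ} (hε : 0 < ε)
    (hcrit : ∀ ξ : ClosedCurve ι, L.IsSmoothField ξ → L.firstVariationLength ξ = -1 →
      L.firstVariationThickness ξ ≤ -ε) {i : ι}
    (h : (L i).length ≠ ⊤) (hpos : 0 < (L i).len) {Ξ : ℝ → E3} (hΞ : ContDiff ℝ ∞ Ξ)
    (hper : Function.Periodic Ξ (L i).len)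
    (hneg : ∫ s in 0..(L i).len, ⟪deriv (L i).arclengthParam s, deriv Ξ s⟫ < 0) :
    (∃ j k : ι, j ≠ k) ∧
    ∃ σ, ∃ y ∈ L.others i, dist ((L i).arclengthParam σ) y = L.linkThickness ∧
      ⟪(L i).arclengthParam σ - y, Ξ σ⟫ ≤ L.linkThickness *
        (ε * ∫ s in 0..(L i).len, ⟪deriv (L i).arclengthParam s, deriv Ξ s⟫) := by
  classical
  set b := ∫ s in 0..(L i).len, ⟪deriv (L i).arclengthParam s, deriv Ξ s⟫ with hb
  -- Rescaling makes the first variation of length equal to `-1`.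
  set Ξ' : ℝ → E3 := (-b)⁻¹ • Ξ with hΞ'
  have hsm : ContDiff ℝ ∞ Ξ' := contDiff_const.smul hΞ
  have hper' : Function.Periodic Ξ' (L i).len := fun s => by simp [hΞ', hper s]
  obtain ⟨ξ, hξ⟩ := Loop.exists_field h hsm.continuous hper'
  have hd : ∀ s, deriv Ξ' s = (-b)⁻¹ • deriv Ξ s := fun s =>
    deriv_const_smul _ ((hΞ.differentiable (by simp)).differentiableAt)
  have hlen : L.firstVariationLength (singleField i ξ) = -1 := by
    rw [firstVariationLength_singleField h hpos (hsm.of_le (by exact_mod_cast le_top)) hξ]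
    simp only [hd, inner_smul_right]
    rw [intervalIntegral.integral_const_mul, ← hb, inv_neg, neg_mul, inv_mul_cancel₀ hneg.ne]
  have hsmooth : L.IsSmoothField (singleField i ξ) := by
    intro k
    by_cases hk : k = i
    · subst hk
      exact ⟨Ξ', hsm, by simpa [singleField] using hξ⟩
    · exact ⟨0, contDiff_const, by simp [singleField, hk]⟩
  have hthick := hcrit _ hsmooth hlen
  have hne : L.firstVariationThickness (singleField i ξ) ≠ 0 := by linarith
  refine ⟨exists_ne_of_firstVariationThickness_ne_zero hne, ?_⟩
  have hstrut : ∃ j, j ≠ i ∧ ∃ x y, dist (L i x) (L j y) = L.linkThickness ∧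
      ⟪L i x - L j y, ξ x⟫ ≤ L.linkThickness * (-ε) := by
    obtain ⟨i', j', hij, x, y, hdist, hin⟩ := exists_strut_inner_le hne
    have hin' := hin.trans (mul_le_mul_of_nonneg_left hthick L.linkThickness_nonneg)
    by_cases hi : i' = i
    · subst hi
      refine ⟨j', hij.symm, x, y, hdist, ?_⟩
      simpa [singleField, hij.symm] using hin'
    · by_cases hj : j' = i
      · subst hj
        refine ⟨i', hij, y, x, by rwa [dist_comm], ?_⟩
        have e : ⟪L j' y - L i' x, ξ y⟫ = ⟪L i' x - L j' y, 0 - ξ y⟫ := by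
          rw [zero_sub, inner_neg_right, ← inner_neg_left, neg_sub]
        rw [e]
        simpa [singleField, hij] using hin'
      -- A strut that misses component `i` is not moved, which would give `0 ≤ -θ * ε` with `θ > 0`.
      · have hpos' := hL.linkThickness_pos ⟨i', j', hij⟩
        simp only [singleField, if_neg hi, if_neg hj, ContinuousMap.zero_apply, sub_zero,
          inner_zero_right] at hin'
        nlinarith
  obtain ⟨j, hj, x, y, hdist, hin⟩ := hstrut
  obtain ⟨t, rfl⟩ := QuotientAddGroup.mk_surjective x
  change dist ((L i).lift t) _ = _ at hdist
  change ⟪(L i).lift t - _, ξ (t : UnitAddCircle)⟫ ≤ _ at hin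
  rw [← Loop.arclengthParam_arclength h] at hdist hin
  refine ⟨(L i).arclength t, L j y, mem_biUnion (show j ∈ {j | j ≠ i} from hj) ⟨y, rfl⟩, hdist, ?_⟩
  rw [hξ, hΞ', Pi.smul_apply, inner_smul_right, inv_mul_le_iff₀ (by linarith)] at hin
  linarith

theorem linkThickness_le_dist_others {L : ClosedCurve ι} {i : ι} (h : (L i).length ≠ ⊤)
    (hpos : 0 < (L i).len) (σ : ℝ) {y : E3} (hy : y ∈ L.others i) :
    L.linkThickness ≤ dist ((L i).arclengthParam σ) y := by
  obtain ⟨t, rfl⟩ := Loop.surjective_arclength h hpos σ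
  simp only [others, mem_iUnion] at hy
  obtain ⟨j, hj, y, rfl⟩ := hy
  rw [Loop.arclengthParam_arclength h]
  exact L.linkThickness_le (Ne.symm hj) (t : UnitAddCircle) y

end ClosedCurve

/-! ### Compactly supported variation fields -/

section Periodization

variable {F : Type*} [NormedAddCommGroup F] [NormedSpace ℝ F]

/-- A smooth function supported in an interval shorter than `l` extends to a smooth `l`-periodic
function. -/
theorem exists_periodic_extension {Ξ : ℝ → F} (hΞ : ContDiff ℝ ∞ Ξ) {l p q : ℝ} (hl : 0 < l)
    (hle : p ≤ q) (hpq : q - p < l) (hsupp : ∀ s, s ∉ Icc p q → Ξ s = 0) :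
    ∃ Ξ' : ℝ → F, ContDiff ℝ ∞ Ξ' ∧ Function.Periodic Ξ' l ∧
      (∀ s ∈ Ioo (q - l) (p + l), Ξ' s = Ξ s) ∧ ∀ s, ∃ n : ℤ, Ξ' s = Ξ (s - n * l) := by
  -- The fundamental domain `[c, c + l)` is centred at the midpoint of `[p, q]`. The open interval
  -- `(q - l, p + l)` contains its closure, so smoothness is preserved at the seams.
  set c := (p + q - l) / 2 with hc
  have hper : Function.Periodic (fun s => Ξ (toIcoMod hl c s)) l := fun s => by
    simp only [toIcoMod_add_right]
  have hloc : ∀ s ∈ Ioo (q - l) (p + l), Ξ (toIcoMod hl c s) = Ξ s := by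
    intro s hs
    rcases lt_or_ge s c with h | h
    · have e : toIcoMod hl c s = s + l := by
        rw [← toIcoMod_add_right, toIcoMod_eq_self hl]
        constructor <;> linarith [hs.1, hs.2]
      rw [e, hsupp s (fun hm => by linarith [hm.1]),
        hsupp (s + l) (fun hm => by linarith [hm.2, hs.1])]
    · rcases lt_or_ge s (c + l) with h' | h'
      · rw [(toIcoMod_eq_self hl).2 ⟨h, h'⟩]
      · have e : toIcoMod hl c s = s - l := by
          rw [← toIcoMod_sub, toIcoMod_eq_self hl]
          constructor <;> linarith [hs.1, hs.2]
        rw [e, hsupp s (fun hm => by linarith [hm.2]),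
          hsupp (s - l) (fun hm => by linarith [hm.1, hs.2])]
  refine ⟨fun s => Ξ (toIcoMod hl c s), ?_, hper, hloc, fun s => ⟨toIcoDiv hl c s, ?_⟩⟩
  · rw [contDiff_iff_contDiffAt]
    intro s
    set m := toIcoDiv hl c s
    have hs : s - m * l ∈ Ico c (c + l) := by
      have := sub_toIcoDiv_zsmul_mem_Ico hl c s
      rwa [zsmul_eq_mul] at this
    have hev : (fun x => Ξ (toIcoMod hl c x)) =ᶠ[𝓝 s] fun x => Ξ (x - m * l) := by
      have ho : ∀ᶠ x in 𝓝 s, x - m * l ∈ Ioo (q - l) (p + l) := by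
        refine (continuous_id.sub continuous_const).continuousAt.eventually
          (Ioo_mem_nhds ?_ ?_)
        · change q - l < s - m * l
          linarith [hs.1]
        · change s - m * l < p + l
          linarith [hs.2]
      filter_upwards [ho] with x hx
      rw [← hloc _ hx]
      exact (hper.sub_int_mul_eq m).symm
    exact (hΞ.comp (contDiff_id.sub contDiff_const)).contDiffAt.congr_of_eventuallyEq hev
  · change Ξ (toIcoMod hl c s) = _
    rw [← self_sub_toIcoDiv_zsmul hl c s, zsmul_eq_mul]

end Periodization

/-- The variational inequality satisfied by the arclength parametrization `g` of a component of
a strongly critical link, where `Y` is the union of the other components, and `θ` is the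
thickness of the link. -/
def VariationalInequality (g : ℝ → E3) (l : ℝ) (Y : Set E3) (θ ε : ℝ) : Prop :=
  ∀ Ξ : ℝ → E3, ContDiff ℝ ∞ Ξ → Function.Periodic Ξ l →
    ∫ s in 0..l, ⟪deriv g s, deriv Ξ s⟫ < 0 →
    0 < θ ∧ ∃ σ, ∃ y ∈ Y, dist (g σ) y = θ ∧
      ⟪g σ - y, Ξ σ⟫ ≤ θ * (ε * ∫ s in 0..l, ⟪deriv g s, deriv Ξ s⟫)

theorem periodic_deriv {F : Type*} [NormedAddCommGroup F] [NormedSpace ℝ F] {f : ℝ → F} {l : ℝ}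
    (hf : Function.Periodic f l) : Function.Periodic (deriv f) l := fun s => by
  rw [← deriv_comp_add_const]
  congr 1
  exact funext hf

theorem support_deriv_subset_Icc {F : Type*} [NormedAddCommGroup F] [NormedSpace ℝ F]
    {f : ℝ → F} {p q : ℝ} (hf : ∀ s, s ∉ Icc p q → f s = 0) :
    Function.support (deriv f) ⊆ Icc p q := by
  refine support_deriv_subset.trans (closure_minimal ?_ isClosed_Icc)
  intro s hs
  by_contra h
  exact hs (hf s h)

/-- The variational inequality for compactly supported fields. -/
theorem VariationalInequality.of_support {g : ℝ → E3} {l : ℝ} {Y : Set E3} {θ ε : ℝ}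
    (hv : VariationalInequality g l Y θ ε) (hl : 0 < l) (hε : 0 < ε)
    (hper : Function.Periodic g l) {Ξ : ℝ → E3} (hΞ : ContDiff ℝ ∞ Ξ) {p q : ℝ}
    (hle : p ≤ q) (hpq : q - p < l) (hsupp : ∀ s, s ∉ Icc p q → Ξ s = 0)
    (hneg : ∫ s, ⟪deriv g s, deriv Ξ s⟫ < 0) :
    0 < θ ∧ ∃ σ ∈ Icc p q, ∃ y ∈ Y, dist (g σ) y = θ ∧
      ⟪g σ - y, Ξ σ⟫ ≤ θ * (ε * ∫ s, ⟪deriv g s, deriv Ξ s⟫) := by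
  obtain ⟨Ξ', hsm, hper', hloc, hval⟩ := exists_periodic_extension hΞ hl hle hpq hsupp
  have hint : ∫ s in 0..l, ⟪deriv g s, deriv Ξ' s⟫ = ∫ s, ⟪deriv g s, deriv Ξ s⟫ := by
    set c := (p + q - l) / 2 with hc
    have hp2 : Function.Periodic (fun s => ⟪deriv g s, deriv Ξ' s⟫) l := fun s => by
      simp only [periodic_deriv hper s, periodic_deriv hper' s]
    have h1 := hp2.intervalIntegral_add_eq 0 c
    rw [zero_add] at h1
    rw [h1]
    have h2 : ∫ s in c..c + l, ⟪deriv g s, deriv Ξ' s⟫ = ∫ s in c..c + l, ⟪deriv g s, deriv Ξ s⟫ := by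
      refine intervalIntegral.integral_congr fun s hs => ?_
      rw [uIcc_of_le (by linarith)] at hs
      have : Ξ' =ᶠ[𝓝 s] Ξ := by
        filter_upwards [Ioo_mem_nhds (show q - l < s by linarith [hs.1])
          (show s < p + l by linarith [hs.2])] with x hx using hloc x hx
      simp only [this.deriv_eq]
    rw [h2, intervalIntegral.integral_eq_integral_of_support_subset]
    intro s hs
    have hs' : s ∈ Icc p q := support_deriv_subset_Icc hsupp fun h0 => hs (by simp [h0])
    exact ⟨by linarith [hs'.1], by linarith [hs'.2]⟩
  obtain ⟨hθ, σ, y, hy, hd, hin⟩ := hv Ξ' hsm hper' (by rwa [hint])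
  refine ⟨hθ, ?_⟩
  rw [hint] at hin
  obtain ⟨n, hn⟩ := hval σ
  have hgn : g (σ - n * l) = g σ := hper.sub_int_mul_eq n
  refine ⟨σ - n * l, ?_, y, hy, by rw [hgn, hd], by rwa [hgn, ← hn]⟩
  -- Outside `[p, q]` the field vanishes, so the left side of the strut inequality would be zero,
  -- but its right side is negative.
  by_contra h
  rw [hn, hsupp _ h, inner_zero_right] at hin
  nlinarith [mul_pos hθ hε]

/-! ### Smoothed step functions and the mollified tangent -/

section Mollification

variable (φ : ContDiffBump (0 : ℝ))

/-- The primitive of a normalized bump function. -/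
noncomputable def ramp (x : ℝ) : ℝ := ∫ t in 0..x, φ.normed volume t

theorem integrable_normed : Integrable (φ.normed (volume : Measure ℝ)) :=
  φ.continuous_normed.integrable_of_hasCompactSupport φ.hasCompactSupport_normed

theorem ramp_sub (x y : ℝ) : ramp φ y - ramp φ x = ∫ t in x..y, φ.normed volume t :=
  intervalIntegral.integral_interval_sub_left (φ.continuous_normed.intervalIntegrable _ _)
    (φ.continuous_normed.intervalIntegrable _ _)

theorem hasDerivAt_ramp (x : ℝ) : HasDerivAt (ramp φ) (φ.normed volume x) x :=
  intervalIntegral.integral_hasDerivAt_right (φ.continuous_normed.intervalIntegrable _ _)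
    (φ.continuous_normed.stronglyMeasurableAtFilter _ _) φ.continuous_normed.continuousAt

theorem contDiff_ramp : ContDiff ℝ ∞ (ramp φ) := by
  rw [contDiff_infty_iff_deriv]
  refine ⟨fun x => (hasDerivAt_ramp φ x).differentiableAt, ?_⟩
  rw [show deriv (ramp φ) = φ.normed volume from funext fun x => (hasDerivAt_ramp φ x).deriv]
  exact φ.contDiff_normed

theorem monotone_ramp : Monotone (ramp φ) := fun x y hxy => by
  rw [← sub_nonneg, ramp_sub]
  exact intervalIntegral.integral_nonneg hxy fun t _ => φ.nonneg_normed t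

theorem ramp_sub_le_one {x y : ℝ} (hxy : x ≤ y) : ramp φ y - ramp φ x ≤ 1 := by
  rw [ramp_sub, intervalIntegral.integral_of_le hxy, ← φ.integral_normed (μ := volume)]
  exact setIntegral_le_integral (integrable_normed φ) (ae_of_all _ fun t => φ.nonneg_normed t)

theorem normed_eq_zero {t : ℝ} (ht : φ.rOut ≤ |t|) : φ.normed volume t = 0 := by
  rw [← Function.notMem_support, φ.support_normed_eq]
  simpa using ht

theorem ramp_eq_of_le {x y : ℝ} (hx : x ≤ -φ.rOut) (hy : y ≤ -φ.rOut) : ramp φ x = ramp φ y := by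
  rw [← sub_eq_zero, ramp_sub]
  refine intervalIntegral.integral_zero_ae (ae_of_all _ fun t ht => normed_eq_zero φ ?_)
  have := (uIoc_subset_uIcc ht).2
  rw [le_abs]
  right
  linarith [this.trans (sup_le hy hx)]

theorem ramp_eq_of_ge {x y : ℝ} (hx : φ.rOut ≤ x) (hy : φ.rOut ≤ y) : ramp φ x = ramp φ y := by
  rw [← sub_eq_zero, ramp_sub]
  refine intervalIntegral.integral_zero_ae (ae_of_all _ fun t ht => normed_eq_zero φ ?_)
  have := (uIoc_subset_uIcc ht).1
  rw [le_abs]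
  left
  exact (le_inf hy hx).trans this

/-- A smooth approximation of the step function with the value `v k` on `[s k, s (k + 1)]`. -/
noncomputable def stepField (n : ℕ) (s : ℕ → ℝ) (v : ℕ → E3) (σ : ℝ) : E3 :=
  ∑ k ∈ Finset.range n, (ramp φ (σ - s k) - ramp φ (σ - s (k + 1))) • v k

variable {φ} {n : ℕ} {s : ℕ → ℝ} {v : ℕ → E3}

theorem contDiff_stepField : ContDiff ℝ ∞ (stepField φ n s v) := by
  have : ∀ c : ℝ, ContDiff ℝ ∞ fun σ => ramp φ (σ - c) := fun c =>
    (contDiff_ramp φ).comp (contDiff_id.sub contDiff_const)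
  exact ContDiff.sum fun k _ => ((this _).sub (this _)).smul contDiff_const

theorem deriv_stepField (σ : ℝ) : deriv (stepField φ n s v) σ =
    ∑ k ∈ Finset.range n,
      (φ.normed volume (σ - s k) - φ.normed volume (σ - s (k + 1))) • v k := by
  have : ∀ c : ℝ, HasDerivAt (fun σ => ramp φ (σ - c)) (φ.normed volume (σ - c)) σ := fun c =>
    (hasDerivAt_ramp φ (σ - c)).comp_sub_const σ c
  exact (HasDerivAt.fun_sum fun k _ => ((this (s k)).sub (this (s (k + 1)))).smul_const (v k)).deriv

/-- The coefficients of the `v k` are nonnegative and telescope to at most `1`. -/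
theorem norm_stepField_le (hs : Monotone s) {C : ℝ} (hv : ∀ k, ‖v k‖ ≤ C) (σ : ℝ) :
    ‖stepField φ n s v σ‖ ≤ C := by
  have hC : 0 ≤ C := (norm_nonneg _).trans (hv 0)
  calc ‖stepField φ n s v σ‖
      ≤ ∑ k ∈ Finset.range n, (ramp φ (σ - s k) - ramp φ (σ - s (k + 1))) * C := by
        refine norm_sum_le_of_le _ fun k _ => ?_
        have h0 : 0 ≤ ramp φ (σ - s k) - ramp φ (σ - s (k + 1)) :=
          sub_nonneg.2 (monotone_ramp φ (by linarith [hs (Nat.le_succ k)]))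
        rw [norm_smul, Real.norm_eq_abs, abs_of_nonneg h0]
        exact mul_le_mul_of_nonneg_left (hv k) h0
    _ = (ramp φ (σ - s 0) - ramp φ (σ - s n)) * C := by
        rw [← Finset.sum_mul, Finset.sum_range_sub']
    _ ≤ 1 * C := mul_le_mul_of_nonneg_right
        (ramp_sub_le_one φ (by linarith [hs (Nat.zero_le n)])) hC
    _ = C := one_mul C

theorem stepField_eq_zero (hs : Monotone s) {σ : ℝ}
    (hσ : σ ∉ Icc (s 0 - φ.rOut) (s n + φ.rOut)) : stepField φ n s v σ = 0 := by
  refine Finset.sum_eq_zero fun k hk => ?_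
  rw [Finset.mem_range] at hk
  have h0 := hs (Nat.zero_le k)
  have h1 := hs (Nat.le_succ k)
  have h2 := hs (Nat.succ_le_of_lt hk)
  have e : ramp φ (σ - s k) = ramp φ (σ - s (k + 1)) := by
    rcases lt_or_ge σ (s 0 - φ.rOut) with h | h
    · exact ramp_eq_of_le φ (by linarith) (by simp only [Nat.succ_eq_add_one] at *; linarith)
    · have h' : s n + φ.rOut < σ := by
        by_contra h'
        exact hσ ⟨h, not_lt.1 h'⟩
      exact ramp_eq_of_ge φ (by simp only [Nat.succ_eq_add_one] at *; linarith)
        (by simp only [Nat.succ_eq_add_one] at *; linarith)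
  rw [e, sub_self, zero_smul]

variable (φ) in
/-- The mollified tangent vector. -/
noncomputable def mollifiedDeriv (g : ℝ → E3) : ℝ → E3 :=
  convolution (φ.normed volume) (deriv g) (ContinuousLinearMap.lsmul ℝ ℝ) volume

theorem mollifiedDeriv_eq (g : ℝ → E3) (c : ℝ) :
    mollifiedDeriv φ g c = ∫ σ, φ.normed volume (σ - c) • deriv g σ := by
  rw [mollifiedDeriv, convolution_lsmul_swap]
  congr 1
  ext1 σ
  rw [← φ.normed_neg, neg_sub]

variable {g : ℝ → E3}

theorem integrable_normed_smul_deriv (hg : LipschitzWith 1 g) (c : ℝ) :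
    Integrable fun σ => φ.normed volume (σ - c) • deriv g σ := by
  have hc : Continuous fun σ : ℝ => σ - c := continuous_id.sub continuous_const
  refine (locallyIntegrable_deriv hg).integrable_smul_left_of_hasCompactSupport
    (φ.continuous_normed.comp hc) ?_
  exact φ.hasCompactSupport_normed.comp_homeomorph (Homeomorph.subRight c)

/-- The derivative of a smoothed step is a difference of two bumps, and pairing a bump with `g'`
evaluates the mollified tangent at its centre. -/
theorem integral_inner_deriv_stepField (hg : LipschitzWith 1 g) :
    ∫ σ, ⟪deriv g σ, deriv (stepField φ n s v) σ⟫ =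
      ∑ k ∈ Finset.range n, ⟪v k, mollifiedDeriv φ g (s k) - mollifiedDeriv φ g (s (k + 1))⟫ := by
  have hi : ∀ k c, Integrable fun σ => ⟪v k, φ.normed volume (σ - c) • deriv g σ⟫ := fun k c =>
    (integrable_normed_smul_deriv hg c).const_inner (v k)
  have e : ∀ σ, ⟪deriv g σ, deriv (stepField φ n s v) σ⟫ = ∑ k ∈ Finset.range n,
      (⟪v k, φ.normed volume (σ - s k) • deriv g σ⟫ -
        ⟪v k, φ.normed volume (σ - s (k + 1)) • deriv g σ⟫) := by
    intro σ
    rw [deriv_stepField, inner_sum]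
    refine Finset.sum_congr rfl fun k _ => ?_
    rw [inner_smul_right, inner_smul_right, inner_smul_right, real_inner_comm (v k)]
    ring
  simp only [e]
  rw [integral_finsetSum _ fun k _ => by exact (hi k (s k)).sub (hi k (s (k + 1)))]
  refine Finset.sum_congr rfl fun k _ => ?_
  rw [integral_sub (hi k _) (hi k _), integral_inner (integrable_normed_smul_deriv hg _),
    integral_inner (integrable_normed_smul_deriv hg _), inner_sub_right, mollifiedDeriv_eq,
    mollifiedDeriv_eq]

/-- Duality: testing with the unit vectors along the increments turns the pairing into minus the
variation sum, while the field has norm at most `1`. -/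
theorem VariationalInequality.eVariationOn_mollifiedDeriv_le {l : ℝ} {Y : Set E3} {θ ε : ℝ}
    (hv : VariationalInequality g l Y θ ε) (hl : 0 < l) (hε : 0 < ε)
    (hg : LipschitzWith 1 g) (hper : Function.Periodic g l) {a b : ℝ}
    (hab : b - a + 2 * φ.rOut < l) :
    eVariationOn (mollifiedDeriv φ g) (Icc a b) ≤ ENNReal.ofReal ε⁻¹ := by
  refine iSup_le fun p => ?_
  obtain ⟨n, u, hu, hmem⟩ := p
  simp only [edist_dist]
  rw [← ENNReal.ofReal_sum_of_nonneg fun _ _ => dist_nonneg]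
  refine ENNReal.ofReal_le_ofReal ?_
  set S := ∑ k ∈ Finset.range n,
    dist (mollifiedDeriv φ g (u (k + 1))) (mollifiedDeriv φ g (u k)) with hS
  rcases le_or_gt S 0 with hS0 | hS0
  · exact hS0.trans (inv_nonneg.2 hε.le)
  let w : ℕ → E3 := fun k => mollifiedDeriv φ g (u (k + 1)) - mollifiedDeriv φ g (u k)
  let v : ℕ → E3 := fun k => ‖w k‖⁻¹ • w k
  have hv1 : ∀ k, ‖v k‖ ≤ 1 := fun k => by
    rw [norm_smul, norm_inv, norm_norm]
    exact inv_mul_le_one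
  have hint : ∫ σ, ⟪deriv g σ, deriv (stepField φ n u v) σ⟫ = -S := by
    rw [integral_inner_deriv_stepField hg, hS, ← Finset.sum_neg_distrib]
    refine Finset.sum_congr rfl fun k _ => ?_
    rw [← neg_sub, inner_neg_right, dist_eq_norm]
    change -⟪‖w k‖⁻¹ • w k, w k⟫ = -‖w k‖
    rw [real_inner_smul_left, real_inner_self_eq_norm_sq, sq]
    rcases eq_or_ne ‖w k‖ 0 with h0 | h0
    · simp [h0]
    · field_simp
  obtain ⟨hθ, σ, -, y, -, hd, hin⟩ := hv.of_support hl hε hper contDiff_stepField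
    (p := u 0 - φ.rOut) (q := u n + φ.rOut)
    (by linarith [hu (Nat.zero_le n), φ.rOut_pos]) (by linarith [(hmem 0).1, (hmem n).2])
    (fun σ hσ => stepField_eq_zero hu hσ) (by rw [hint]; linarith)
  rw [hint] at hin
  -- Cauchy–Schwarz on the strut gives `-θ ≤ ⟪g σ - y, Ξ σ⟫ ≤ -θ * ε * S`, so `S ≤ 1 / ε`.
  have h1 := neg_le_of_abs_le ((abs_real_inner_le_norm (g σ - y) (stepField φ n u v σ)).trans
    (mul_le_of_le_one_right (norm_nonneg _) (norm_stepField_le hu hv1 σ)))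
  rw [← dist_eq_norm, hd] at h1
  rw [← one_div, le_div_iff₀ hε]
  have h2 : θ * (S * ε) ≤ θ * 1 := by linarith
  exact le_of_mul_le_mul_left h2 hθ

end Mollification

/-! ### Limits along almost every parameter -/

section AlmostEverywhereLimits

theorem neBot_nhdsGT_inf_ae (x : ℝ) : (𝓝[>] x ⊓ ae (volume : Measure ℝ)).NeBot := by
  rw [inf_neBot_iff]
  intro U hU V hV
  obtain ⟨u, hu, hsub⟩ := mem_nhdsGT_iff_exists_Ioo_subset.1 hU
  have hpos : (volume (Ioo x u)) ≠ 0 := by simpa using hu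
  obtain ⟨z, hz, hzV⟩ := (frequently_ae_mem_iff.2 hpos).and_eventually hV |>.exists
  exact ⟨z, hsub hz, hzV⟩

theorem neBot_nhdsLT_inf_ae (x : ℝ) : (𝓝[<] x ⊓ ae (volume : Measure ℝ)).NeBot := by
  rw [inf_neBot_iff]
  intro U hU V hV
  obtain ⟨u, hu, hsub⟩ := mem_nhdsLT_iff_exists_Ioo_subset.1 hU
  have hpos : (volume (Ioo u x)) ≠ 0 := by simpa using hu
  obtain ⟨z, hz, hzV⟩ := (frequently_ae_mem_iff.2 hpos).and_eventually hV |>.exists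
  exact ⟨z, hsub hz, hzV⟩

theorem nhds_inf_ae_le (x : ℝ) : 𝓝 x ⊓ ae (volume : Measure ℝ) ≤
    (𝓝[<] x ⊓ ae volume) ⊔ (𝓝[>] x ⊓ ae volume) := by
  rw [← inf_sup_right, nhdsLT_sup_nhdsGT, nhdsWithin]
  refine le_inf (le_inf inf_le_left (inf_le_right.trans ?_)) inf_le_right
  rw [le_principal_iff, mem_ae_iff, compl_compl]
  exact Real.volume_singleton

/-- At each `z` near `x`, the value `f z` is itself a limit of values in a closed ball about `f x`,
hence lies in that ball. -/
theorem continuous_of_tendsto_nhds_inf_ae {F : Type*} [PseudoMetricSpace F] {f : ℝ → F}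
    (hf : ∀ x, Tendsto f (𝓝 x ⊓ ae volume) (𝓝 (f x))) : Continuous f := by
  rw [continuous_iff_continuousAt]
  intro x
  rw [ContinuousAt, Metric.nhds_basis_closedBall.tendsto_right_iff]
  intro r hr
  obtain ⟨U, hU, V, hV, hUV⟩ := eventually_inf.1 ((hf x) (Metric.closedBall_mem_nhds _ hr))
  filter_upwards [eventually_mem_nhds_iff.2 hU] with z hz
  have : (𝓝 z ⊓ ae (volume : Measure ℝ)).NeBot :=
    (neBot_nhdsGT_inf_ae z).mono (inf_le_inf_right _ nhdsWithin_le_nhds)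
  exact Metric.isClosed_closedBall.mem_of_tendsto (hf z)
    (eventually_inf.2 ⟨U, hz, V, hV, fun y hy => hUV y hy⟩)

theorem exists_tendsto_nhdsGT_inf_ae {F : Type*} [PseudoMetricSpace F] [CompleteSpace F]
    {f : ℝ → F} {S : Set ℝ} (hS : S ∈ ae (volume : Measure ℝ)) {a b x : ℝ} (hx : x ∈ Ioo a b)
    (hf : BoundedVariationOn f (S ∩ Icc a b)) :
    ∃ y, Tendsto f (𝓝[>] x ⊓ ae volume) (𝓝 y) := by
  obtain ⟨y, hy⟩ := hf.exists_tendsto_right x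
  refine ⟨y, hy.mono_left (le_inf (inf_le_left.trans nhdsWithin_le_nhds) ?_)⟩
  rw [le_principal_iff]
  exact inter_mem (inter_mem (mem_inf_of_right hS)
    (mem_inf_of_left (mem_nhdsWithin_of_mem_nhds (Icc_mem_nhds hx.1 hx.2))))
    (mem_inf_of_left self_mem_nhdsWithin)

theorem exists_tendsto_nhdsLT_inf_ae {F : Type*} [PseudoMetricSpace F] [CompleteSpace F]
    {f : ℝ → F} {S : Set ℝ} (hS : S ∈ ae (volume : Measure ℝ)) {a b x : ℝ} (hx : x ∈ Ioo a b)
    (hf : BoundedVariationOn f (S ∩ Icc a b)) :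
    ∃ y, Tendsto f (𝓝[<] x ⊓ ae volume) (𝓝 y) := by
  obtain ⟨y, hy⟩ := hf.exists_tendsto_left x
  refine ⟨y, hy.mono_left (le_inf (inf_le_left.trans nhdsWithin_le_nhds) ?_)⟩
  rw [le_principal_iff]
  exact inter_mem (inter_mem (mem_inf_of_right hS)
    (mem_inf_of_left (mem_nhdsWithin_of_mem_nhds (Icc_mem_nhds hx.1 hx.2))))
    (mem_inf_of_left self_mem_nhdsWithin)

end AlmostEverywhereLimits

/-! ### One-sided tangents and the first-order condition at a strut -/

section OneSidedDerivatives

theorem nonneg_of_hasDerivWithinAt_Ici {h : ℝ → ℝ} {h' x : ℝ}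
    (hd : HasDerivWithinAt h h' (Ici x) x) (hmin : ∀ z, h x ≤ h z) : 0 ≤ h' := by
  have := hasDerivWithinAt_Ioi_iff_Ici.2 hd
  rw [hasDerivWithinAt_iff_tendsto_slope' (by simp)] at this
  refine ge_of_tendsto this ?_
  filter_upwards [self_mem_nhdsWithin] with z hz
  rw [slope_def_field]
  exact div_nonneg (sub_nonneg.2 (hmin z)) (sub_nonneg.2 (le_of_lt hz))

theorem nonpos_of_hasDerivWithinAt_Iic {h : ℝ → ℝ} {h' x : ℝ}
    (hd : HasDerivWithinAt h h' (Iic x) x) (hmin : ∀ z, h x ≤ h z) : h' ≤ 0 := by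
  have := hasDerivWithinAt_Iio_iff_Iic.2 hd
  rw [hasDerivWithinAt_iff_tendsto_slope' (by simp)] at this
  refine le_of_tendsto this ?_
  filter_upwards [self_mem_nhdsWithin] with z hz
  rw [slope_def_field]
  exact div_nonpos_of_nonneg_of_nonpos (sub_nonneg.2 (hmin z)) (sub_nonpos.2 (le_of_lt hz))

variable {g : ℝ → E3}

theorem eq_add_integral_deriv (hg : LipschitzWith 1 g) (x : ℝ) :
    g = fun u => g x + ∫ s in x..u, deriv g s := by
  funext u
  rw [integral_deriv_of_lipschitz hg]
  abel

theorem stronglyMeasurableAtFilter_deriv (g : ℝ → E3) (l : Filter ℝ) :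
    StronglyMeasurableAtFilter (deriv g) l volume :=
  (stronglyMeasurable_deriv g).aestronglyMeasurable.stronglyMeasurableAtFilter

theorem hasDerivWithinAt_Ici_of_tendsto_ae (hg : LipschitzWith 1 g) {x : ℝ} {T : E3}
    (hT : Tendsto (deriv g) (𝓝[>] x ⊓ ae volume) (𝓝 T)) : HasDerivWithinAt g T (Ici x) x := by
  rw [eq_add_integral_deriv hg x]
  exact (intervalIntegral.integral_hasDerivWithinAt_of_tendsto_ae_right
    (intervalIntegrable_deriv hg x x) (stronglyMeasurableAtFilter_deriv g (𝓝[Ioi x] x)) hT).const_add _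

theorem hasDerivWithinAt_Iic_of_tendsto_ae (hg : LipschitzWith 1 g) {x : ℝ} {T : E3}
    (hT : Tendsto (deriv g) (𝓝[<] x ⊓ ae volume) (𝓝 T)) : HasDerivWithinAt g T (Iic x) x := by
  rw [eq_add_integral_deriv hg x]
  have hT' : Tendsto (deriv g) (𝓝[Iic x] x ⊓ ae volume) (𝓝 T) := by
    refine hT.mono_left (le_inf ?_ inf_le_right)
    -- The fundamental theorem of calculus is applied with the filter `𝓝[Iic x] x`, which includes
    -- `x` itself; this point is null and can be discarded.
    rw [← Iio_union_right, nhdsWithin_union, nhdsWithin_singleton, inf_sup_right]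
    refine sup_le inf_le_left ?_
    have : pure x ⊓ ae (volume : Measure ℝ) = ⊥ := by
      rw [← principal_singleton, inf_comm, inf_principal_eq_bot, mem_ae_iff, compl_compl]
      exact Real.volume_singleton
    rw [this]
    exact bot_le
  exact (intervalIntegral.integral_hasDerivWithinAt_of_tendsto_ae_right
    (intervalIntegrable_deriv hg x x) (stronglyMeasurableAtFilter_deriv g (𝓝[Iic x] x)) hT').const_add _

theorem hasDerivAt_of_tendsto_ae (hg : LipschitzWith 1 g) {x : ℝ} {T : E3}
    (hT : Tendsto (deriv g) (𝓝 x ⊓ ae volume) (𝓝 T)) : HasDerivAt g T x := by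
  rw [eq_add_integral_deriv hg x]
  exact (intervalIntegral.integral_hasDerivAt_of_tendsto_ae_right
    (intervalIntegrable_deriv hg x x) (stronglyMeasurableAtFilter_deriv g (𝓝 x)) hT).const_add _

/-- At a point of `g` nearest to `y`, the one-sided tangent vectors do not point towards `y`. -/
theorem inner_sub_nonneg_of_nearest {x : ℝ} {T₁ T₂ y : E3}
    (h₁ : HasDerivWithinAt g T₁ (Iic x) x) (h₂ : HasDerivWithinAt g T₂ (Ici x) x)
    (hmin : ∀ z, dist (g x) y ≤ dist (g z) y) : 0 ≤ ⟪g x - y, T₂ - T₁⟫ := by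
  have hmin' : ∀ z, ‖g x - y‖ ^ 2 ≤ ‖g z - y‖ ^ 2 := fun z => by
    have := hmin z
    rw [dist_eq_norm, dist_eq_norm] at this
    exact pow_le_pow_left₀ (norm_nonneg _) this 2
  have e₁ := nonpos_of_hasDerivWithinAt_Iic (h₁.sub_const y).norm_sq hmin'
  have e₂ := nonneg_of_hasDerivWithinAt_Ici (h₂.sub_const y).norm_sq hmin'
  rw [inner_sub_right]
  linarith

end OneSidedDerivatives

/-! ### Bounded variation of the tangent and absence of corners -/

section Regularity

/-- A sequence of bump functions concentrating at the origin. -/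
noncomputable def shrinkingBump (n : ℕ) : ContDiffBump (0 : ℝ) where
  rIn := 1 / ((n : ℝ) + 1)
  rOut := 2 * (1 / ((n : ℝ) + 1))
  rIn_pos := by positivity
  rIn_lt_rOut := by
    have : 0 < 1 / ((n : ℝ) + 1) := by positivity
    linarith

theorem tendsto_rOut_shrinkingBump : Tendsto (fun n => (shrinkingBump n).rOut) atTop (𝓝 0) := by
  simpa [shrinkingBump] using (tendsto_one_div_add_atTop_nhds_zero_nat (𝕜 := ℝ)).const_mul 2

/-- The set of points where the mollified tangent vectors converge to the tangent vector. -/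
def regularSet (g : ℝ → E3) : Set ℝ :=
  {x | Tendsto (fun n => mollifiedDeriv (shrinkingBump n) g x) atTop (𝓝 (deriv g x))}

variable {g : ℝ → E3}

theorem regularSet_mem_ae (hg : LipschitzWith 1 g) : regularSet g ∈ ae (volume : Measure ℝ) :=
  ContDiffBump.ae_convolution_tendsto_right_of_locallyIntegrable (K := 2)
    tendsto_rOut_shrinkingBump (Eventually.of_forall fun _ => le_rfl) (locallyIntegrable_deriv hg)

theorem regularSet_eq_univ (hc : Continuous (deriv g)) : regularSet g = univ :=
  eq_univ_of_forall fun x =>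
    ContDiffBump.convolution_tendsto_right_of_continuous tendsto_rOut_shrinkingBump hc x

namespace VariationalInequality

variable {l : ℝ} {Y : Set E3} {θ ε : ℝ}

/-- Variation is lower semicontinuous under pointwise convergence, which holds on `regularSet g`.
The bumps are eventually so narrow that `[a, b]`, widened by their radius at both ends, is still
shorter than a period. -/
theorem eVariationOn_deriv_le (hv : VariationalInequality g l Y θ ε) (hl : 0 < l) (hε : 0 < ε)
    (hg : LipschitzWith 1 g) (hper : Function.Periodic g l) {a b : ℝ} (hab : b - a < l) :
    eVariationOn (deriv g) (regularSet g ∩ Icc a b) ≤ ENNReal.ofReal ε⁻¹ := by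
  by_contra! h
  have h1 := eVariationOn.lowerSemicontinuous_aux (p := atTop)
    (F := fun n => mollifiedDeriv (shrinkingBump n) g) (f := deriv g)
    (s := regularSet g ∩ Icc a b) (fun x hx => hx.1) h
  have h2 := tendsto_rOut_shrinkingBump.eventually
    (gt_mem_nhds (show (0 : ℝ) < (l - (b - a)) / 2 by linarith))
  obtain ⟨n, hn1, hn2⟩ := (h1.and h2).exists
  refine absurd hn1 (not_lt.2 ?_)
  exact (eVariationOn.mono _ inter_subset_right).trans
    (hv.eVariationOn_mollifiedDeriv_le hl hε hg hper (by linarith))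

theorem boundedVariationOn_deriv (hv : VariationalInequality g l Y θ ε) (hl : 0 < l)
    (hε : 0 < ε) (hg : LipschitzWith 1 g) (hper : Function.Periodic g l) {a b : ℝ}
    (hab : b - a < l) : BoundedVariationOn (deriv g) (regularSet g ∩ Icc a b) :=
  ne_top_of_le_ne_top ENNReal.ofReal_ne_top (hv.eVariationOn_deriv_le hl hε hg hper hab)

/-- Near a corner there is a strut that pulls in the direction of the corner. -/
theorem exists_strut_near_corner (hv : VariationalInequality g l Y θ ε) (hl : 0 < l)
    (hε : 0 < ε) (hg : LipschitzWith 1 g) (hper : Function.Periodic g l) {x : ℝ} {T₁ T₂ : E3}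
    (h₁ : Tendsto (deriv g) (𝓝[<] x ⊓ ae volume) (𝓝 T₁))
    (h₂ : Tendsto (deriv g) (𝓝[>] x ⊓ ae volume) (𝓝 T₂)) (hne : T₁ ≠ T₂) {δ : ℝ} (hδ : 0 < δ)
    (hδl : 4 * δ < l) :
    0 < θ ∧ ∃ σ ∈ Icc (x - 2 * δ) (x + 2 * δ), ∃ y ∈ Y, dist (g σ) y = θ ∧
      ⟪g σ - y, T₂ - T₁⟫ ≤ -(θ * (ε * (‖T₂ - T₁‖ ^ 2 / 2))) := by
  set w := T₂ - T₁ with hw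
  have hwpos : 0 < ‖w‖ ^ 2 := by
    have : 0 < ‖w‖ := norm_pos_iff.2 (sub_ne_zero.2 hne.symm)
    positivity
  have := neBot_nhdsLT_inf_ae x
  have := neBot_nhdsGT_inf_ae x
  have hreg := regularSet_mem_ae hg
  have hlim : Tendsto (fun z : ℝ × ℝ => ⟪w, deriv g z.1 - deriv g z.2⟫)
      ((𝓝[<] x ⊓ ae volume) ×ˢ (𝓝[>] x ⊓ ae volume)) (𝓝 ⟪w, T₁ - T₂⟫) :=
    tendsto_const_nhds.inner ((h₁.comp tendsto_fst).sub (h₂.comp tendsto_snd))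
  have hlt : ⟪w, T₁ - T₂⟫ < -(‖w‖ ^ 2 / 2) := by
    rw [← neg_sub, ← hw, inner_neg_right, real_inner_self_eq_norm_sq]
    linarith
  -- Choose regular parameters `s₁ < x < s₂` with `⟪w, g' s₁ - g' s₂⟫ < -‖w‖ ^ 2 / 2`; the test
  -- field is a smoothed indicator of `[s₁, s₂]` times `w`.
  have ev₁ : ∀ᶠ z in 𝓝[<] x ⊓ ae volume, z ∈ Ioo (x - δ) x ∧ z ∈ regularSet g :=
    inter_mem (mem_inf_of_left (Ioo_mem_nhdsLT (sub_lt_self x hδ))) (mem_inf_of_right hreg)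
  have ev₂ : ∀ᶠ z in 𝓝[>] x ⊓ ae volume, z ∈ Ioo x (x + δ) ∧ z ∈ regularSet g :=
    inter_mem (mem_inf_of_left (Ioo_mem_nhdsGT (lt_add_of_pos_right x hδ)))
      (mem_inf_of_right hreg)
  obtain ⟨⟨s₁, s₂⟩, hs, ⟨hs₁, hr₁⟩, hs₂, hr₂⟩ :=
    ((hlim.eventually (gt_mem_nhds hlt)).and (ev₁.prod_mk ev₂)).exists
  have hmol : Tendsto (fun n => ⟪w, mollifiedDeriv (shrinkingBump n) g s₁ -
      mollifiedDeriv (shrinkingBump n) g s₂⟫) atTop (𝓝 ⟪w, deriv g s₁ - deriv g s₂⟫) :=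
    tendsto_const_nhds.inner (Tendsto.sub hr₁ hr₂)
  obtain ⟨n, hn, hnδ⟩ := ((hmol.eventually (gt_mem_nhds hs)).and
    (tendsto_rOut_shrinkingBump.eventually (gt_mem_nhds hδ))).exists
  set φ := shrinkingBump n
  let s : ℕ → ℝ := fun k => if k = 0 then s₁ else s₂
  have hmono : Monotone s := monotone_nat_of_le_succ fun k => by
    by_cases hk : k = 0
    · simp only [s, hk, if_true, zero_add, one_ne_zero, if_false]
      linarith [hs₁.2, hs₂.1]
    · simp [s, hk]
  have hint : ∫ σ, ⟪deriv g σ, deriv (stepField φ 1 s fun _ => w) σ⟫ < -(‖w‖ ^ 2 / 2) := by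
    rw [integral_inner_deriv_stepField hg]
    simpa [s] using hn
  obtain ⟨hθ, σ, hσ, y, hy, hd, hin⟩ := hv.of_support hl hε hper contDiff_stepField
    (p := s₁ - φ.rOut) (q := s₂ + φ.rOut) (by linarith [hs₁.2, hs₂.1, φ.rOut_pos])
    (by linarith [hs₁.1, hs₂.2])
    (fun σ hσ => stepField_eq_zero (n := 1) hmono (by simpa [s] using hσ)) (by linarith)
  refine ⟨hθ, σ, ⟨by linarith [hσ.1, hs₁.1], by linarith [hσ.2, hs₂.2]⟩, y, hy, hd, ?_⟩
  set c := ramp φ (σ - s₁) - ramp φ (σ - s₂) with hc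
  have hss : σ - s₂ ≤ σ - s₁ := by linarith [hs₁.2, hs₂.1]
  have hc0 : 0 ≤ c := sub_nonneg.2 (monotone_ramp φ hss)
  have hc1 : c ≤ 1 := ramp_sub_le_one φ hss
  have hfield : stepField φ 1 s (fun _ => w) σ = c • w := by simp [stepField, s, hc]
  rw [hfield, inner_smul_right] at hin
  have h3 := mul_lt_mul_of_pos_left (mul_lt_mul_of_pos_left hint hε) hθ
  have h4 : 0 < θ * (ε * (‖w‖ ^ 2 / 2)) := by positivity
  rw [mul_neg, mul_neg] at h3
  -- The bound is for `c * ⟪g σ - y, w⟫`; as the inner product is negative and `0 ≤ c ≤ 1`, removing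
  -- `c` only decreases the left side.
  have h5 : ⟪g σ - y, w⟫ < 0 := by
    by_contra h
    linarith [mul_nonneg hc0 (not_lt.1 h)]
  nlinarith

/-- Struts pulling into the corner exist arbitrarily close to `x`, and their set is compact, so one
starts at `x` itself. This contradicts `inner_sub_nonneg_of_nearest`, since a strut realizes the
minimal distance. -/
theorem leftTangent_eq_rightTangent (hv : VariationalInequality g l Y θ ε) (hl : 0 < l)
    (hε : 0 < ε) (hg : LipschitzWith 1 g) (hper : Function.Periodic g l) (hY : IsCompact Y)
    (hθY : ∀ σ, ∀ y ∈ Y, θ ≤ dist (g σ) y) {x : ℝ} {T₁ T₂ : E3}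
    (h₁ : Tendsto (deriv g) (𝓝[<] x ⊓ ae volume) (𝓝 T₁))
    (h₂ : Tendsto (deriv g) (𝓝[>] x ⊓ ae volume) (𝓝 T₂)) : T₁ = T₂ := by
  by_contra hne
  have hnear := fun δ (hδ : (0 : ℝ) < δ) (hδl : 4 * δ < l) =>
    hv.exists_strut_near_corner hl hε hg hper h₁ h₂ hne hδ hδl
  set c := θ * (ε * (‖T₂ - T₁‖ ^ 2 / 2)) with hc
  have hcpos : 0 < c := by
    have hθ := (hnear (l / 8) (by linarith) (by linarith)).1
    have : 0 < ‖T₂ - T₁‖ := norm_pos_iff.2 (sub_ne_zero.2 (Ne.symm hne))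
    positivity
  let K : Set (ℝ × E3) := (Icc (x - l) (x + l) ×ˢ Y) ∩
    {z | dist (g z.1) z.2 = θ ∧ ⟪g z.1 - z.2, T₂ - T₁⟫ ≤ -c}
  have hgc : Continuous fun z : ℝ × E3 => g z.1 := hg.continuous.comp continuous_fst
  have hK : IsCompact K := by
    refine (isCompact_Icc.prod hY).inter_right (IsClosed.inter ?_ ?_)
    · exact isClosed_eq (hgc.dist continuous_snd) continuous_const
    · have hin : Continuous fun z : ℝ × E3 => ⟪g z.1 - z.2, T₂ - T₁⟫ :=
        (hgc.sub continuous_snd).inner continuous_const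
      exact isClosed_le hin continuous_const
  have hmem : x ∈ Prod.fst '' K := by
    rw [← (hK.image continuous_fst).isClosed.closure_eq, Metric.mem_closure_iff]
    intro r hr
    set δ := min (r / 4) (l / 8) with hδ
    have hδ1 : δ ≤ r / 4 := min_le_left _ _
    have hδ2 : δ ≤ l / 8 := min_le_right _ _
    have hδ0 : 0 < δ := lt_min (by linarith) (by linarith)
    obtain ⟨-, σ, hσ, y, hy, hd, hin⟩ := hnear δ hδ0 (by linarith)
    refine ⟨σ, ⟨(σ, y), ⟨⟨⟨?_, ?_⟩, hy⟩, hd, hin⟩, rfl⟩, ?_⟩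
    · linarith [hσ.1]
    · linarith [hσ.2]
    · rw [Real.dist_eq, abs_lt]
      constructor <;> linarith [hσ.1, hσ.2]
  obtain ⟨⟨_, y⟩, ⟨⟨-, hy⟩, hd, hin⟩, rfl⟩ := hmem
  have := inner_sub_nonneg_of_nearest (hasDerivWithinAt_Iic_of_tendsto_ae hg h₁)
    (hasDerivWithinAt_Ici_of_tendsto_ae hg h₂) (y := y) fun z => hd.le.trans (hθY z y hy)
  linarith

theorem contDiff_one (hv : VariationalInequality g l Y θ ε) (hl : 0 < l)
    (hε : 0 < ε) (hg : LipschitzWith 1 g) (hper : Function.Periodic g l) (hY : IsCompact Y)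
    (hθY : ∀ σ, ∀ y ∈ Y, θ ≤ dist (g σ) y) : ContDiff ℝ 1 g := by
  have hlim : ∀ x, ∃ T, Tendsto (deriv g) (𝓝 x ⊓ ae volume) (𝓝 T) := fun x => by
    have hbv := hv.boundedVariationOn_deriv hl hε hg hper
      (show x + l / 4 - (x - l / 4) < l by linarith)
    have hx : x ∈ Ioo (x - l / 4) (x + l / 4) := ⟨by linarith, by linarith⟩
    obtain ⟨T₁, h₁⟩ := exists_tendsto_nhdsLT_inf_ae (regularSet_mem_ae hg) hx hbv
    obtain ⟨T₂, h₂⟩ := exists_tendsto_nhdsGT_inf_ae (regularSet_mem_ae hg) hx hbv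
    obtain rfl := hv.leftTangent_eq_rightTangent hl hε hg hper hY hθY h₁ h₂
    exact ⟨T₁, (h₁.sup h₂).mono_left (nhds_inf_ae_le x)⟩
  choose T hT using hlim
  have hd : ∀ x, HasDerivAt g (T x) x := fun x => hasDerivAt_of_tendsto_ae hg (hT x)
  have e : deriv g = T := funext fun x => (hd x).deriv
  rw [contDiff_one_iff_deriv]
  refine ⟨fun x => (hd x).differentiableAt, continuous_of_tendsto_nhds_inf_ae fun x => ?_⟩
  rw [(hd x).deriv]
  exact hT x

theorem locallyBoundedVariationOn_deriv (hv : VariationalInequality g l Y θ ε) (hl : 0 < l)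
    (hε : 0 < ε) (hg : LipschitzWith 1 g) (hper : Function.Periodic g l)
    (hc : Continuous (deriv g)) : LocallyBoundedVariationOn (deriv g) univ := by
  refine locallyBoundedVariationOn_of_forall_Icc (half_pos hl) fun x => ?_
  have := hv.boundedVariationOn_deriv hl hε hg hper (show x + l / 2 - x < l by linarith)
  rwa [regularSet_eq_univ hc, univ_inter] at this

end VariationalInequality

end Regularity

/-! ### Total curvature of inscribed polygons -/

section TotalCurvature

/-- For `d < 1` the angle is acute and its sine is at most `d`, so Jordan's inequality gives even `π
* d / 2`. The constant `π` also covers `d ≥ 1`, where every angle is at most `π`. -/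
theorem angle_le_of_norm_sub_smul_le {V : Type*} [NormedAddCommGroup V] [InnerProductSpace ℝ V]
    {a e : V} {c d : ℝ} (he : ‖e‖ = 1) (hc : 0 < c) (h : ‖a - c • e‖ ≤ c * d) :
    InnerProductGeometry.angle a e ≤ Real.pi * d := by
  have hd : 0 ≤ d := by
    have := (norm_nonneg _).trans h
    exact nonneg_of_mul_nonneg_right this hc
  rcases le_or_gt 1 d with h1 | h1
  · exact (InnerProductGeometry.angle_le_pi a e).trans
      (le_mul_of_one_le_right Real.pi_pos.le h1)
  set α := InnerProductGeometry.angle a e with hα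
  have hcos : ⟪a, e⟫ = Real.cos α * ‖a‖ := by
    rw [← InnerProductGeometry.cos_angle_mul_norm_mul_norm, he, mul_one]
  have hsq : ‖a - c • e‖ ^ 2 = ‖a‖ ^ 2 - 2 * c * (Real.cos α * ‖a‖) + c ^ 2 := by
    rw [norm_sub_sq_real, inner_smul_right, norm_smul, he, hcos, Real.norm_eq_abs, mul_one, sq_abs]
    ring
  have hle : ‖a - c • e‖ ^ 2 ≤ (c * d) ^ 2 := pow_le_pow_left₀ (norm_nonneg _) h 2
  have hα0 : 0 ≤ α := InnerProductGeometry.angle_nonneg a e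
  have hcd : (c * d) ^ 2 < c ^ 2 := by
    rw [mul_pow]
    exact mul_lt_of_lt_one_right (by positivity) (pow_lt_one₀ hd h1 two_ne_zero)
  have hcospos : 0 < Real.cos α := by
    by_contra hneg
    have := mul_nonneg hc.le (mul_nonneg (neg_nonneg.2 (not_lt.1 hneg)) (norm_nonneg a))
    nlinarith [sq_nonneg ‖a‖]
  have hα1 : α ≤ Real.pi / 2 := by
    by_contra hgt
    exact absurd hcospos (not_lt.2 (Real.cos_nonpos_of_pi_div_two_le_of_le (not_le.1 hgt).le
      (by linarith [InnerProductGeometry.angle_le_pi a e, Real.pi_pos])))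
  -- `c * sin α` is the distance from `c • e` to the line spanned by `a`.
  have hsin : c * Real.sin α ≤ c * d := by
    refine abs_le_of_sq_le_sq' ?_ (by positivity) |>.2
    have := Real.sin_sq_add_cos_sq α
    nlinarith [sq_nonneg (‖a‖ - c * Real.cos α)]
  have hsin' := le_of_mul_le_mul_left hsin hc
  have hj := Real.mul_le_sin hα0 hα1
  have hπ := Real.pi_pos
  have : 2 * α ≤ Real.pi * d := by
    have : 2 / Real.pi * α * Real.pi ≤ d * Real.pi :=
      mul_le_mul_of_nonneg_right (hj.trans hsin') hπ.le
    rw [div_mul_eq_mul_div, div_mul_cancel₀ _ hπ.ne'] at this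
    linarith
  linarith

variable {g : ℝ → E3}

/-- If the speed were below `1` at `x`, then by continuity a short arc at `x` would be shorter than
its parameter interval. -/
theorem norm_deriv_eq_one (hg : LipschitzWith 1 g) (hC : ContDiff ℝ 1 g)
    (hvar : ∀ x y, eVariationOn g (Icc x y) = ENNReal.ofReal (y - x)) (x : ℝ) :
    ‖deriv g x‖ = 1 := by
  refine le_antisymm (norm_deriv_le_one hg x) (not_lt.1 fun hlt => ?_)
  obtain ⟨c, hxc, hc1⟩ := exists_between hlt
  have hc0 : 0 < c := (norm_nonneg _).trans_lt hxc
  have hev := (hC.continuous_deriv le_rfl).norm.continuousAt.eventually (gt_mem_nhds hxc)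
  obtain ⟨δ, hδ, hball⟩ := Metric.eventually_nhds_iff_ball.1 hev
  have hle : eVariationOn g (Icc x (x + δ / 2)) ≤ ENNReal.ofReal (c * (x + δ / 2) - c * x) := by
    refine eVariationOn_Icc_le_of_dist_le (H := fun u => c * u) (by linarith) ?_
    intro u hu v hv huv
    have := (convex_Icc x (x + δ / 2)).norm_image_sub_le_of_norm_deriv_le (f := g) (C := c)
      (fun z _ => (hC.differentiable one_ne_zero).differentiableAt)
      (fun z hz => (hball z ?_).le) hu hv
    · rw [dist_comm, dist_eq_norm]
      rwa [Real.norm_eq_abs, abs_of_nonneg (sub_nonneg.2 huv), mul_sub] at this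
    · rw [Metric.mem_ball, Real.dist_eq, abs_lt]
      constructor <;> linarith [hz.1, hz.2]
  rw [hvar, ENNReal.ofReal_le_ofReal_iff'] at hle
  rcases hle with hle | hle
  · nlinarith
  · linarith

theorem norm_sub_smul_deriv_le (hg : LipschitzWith 1 g) {x y z d : ℝ} (hxy : x ≤ y)
    (h : ∀ u ∈ Icc x y, ‖deriv g u - deriv g z‖ ≤ d) :
    ‖(g y - g x) - (y - x) • deriv g z‖ ≤ (y - x) * d := by
  have e : (g y - g x) - (y - x) • deriv g z = ∫ u in x..y, (deriv g u - deriv g z) := by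
    rw [intervalIntegral.integral_sub (intervalIntegrable_deriv hg x y) intervalIntegrable_const,
      integral_deriv_of_lipschitz hg, intervalIntegral.integral_const]
  rw [e]
  have := intervalIntegral.norm_integral_le_of_norm_le_const (a := x) (b := y) (C := d)
    (f := fun u => deriv g u - deriv g z) fun u hu => by
      rw [uIoc_of_le hxy] at hu
      exact h u (Ioc_subset_Icc_self hu)
  rwa [abs_of_nonneg (sub_nonneg.2 hxy), mul_comm] at this

/-- Compare both edges with the tangent at their common vertex `y`: an edge is an integral of
tangents, each differing from that one by at most the variation in between. -/
theorem angle_sub_sub_le (hg : LipschitzWith 1 g)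
    (hbv : LocallyBoundedVariationOn (deriv g) univ) {x y z : ℝ} (hnorm : ‖deriv g y‖ = 1)
    (hxy : x < y) (hyz : y < z) :
    InnerProductGeometry.angle (g y - g x) (g z - g y) ≤ Real.pi *
      (variationOnFromTo (deriv g) univ 0 z - variationOnFromTo (deriv g) univ 0 x) := by
  set τ := variationOnFromTo (deriv g) univ 0 with hτ
  have hmono : Monotone τ := monotoneOn_univ.1 (variationOnFromTo.monotoneOn hbv (mem_univ 0))
  have h1 : InnerProductGeometry.angle (g y - g x) (deriv g y) ≤ Real.pi * (τ y - τ x) := by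
    refine angle_le_of_norm_sub_smul_le hnorm (sub_pos.2 hxy)
      (norm_sub_smul_deriv_le hg hxy.le fun u hu => ?_)
    rw [← dist_eq_norm]
    exact (dist_le_variationOnFromTo_sub hbv 0 hu.2).trans (sub_le_sub_left (hmono hu.1) _)
  have h2 : InnerProductGeometry.angle (g z - g y) (deriv g y) ≤ Real.pi * (τ z - τ y) := by
    refine angle_le_of_norm_sub_smul_le hnorm (sub_pos.2 hyz)
      (norm_sub_smul_deriv_le hg hyz.le fun u hu => ?_)
    rw [← dist_eq_norm, dist_comm]
    exact (dist_le_variationOnFromTo_sub hbv 0 hu.1).trans (sub_le_sub_right (hmono hu.2) _)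
  have h3 := InnerProductGeometry.angle_le_angle_add_angle (g y - g x) (deriv g y) (g z - g y)
  rw [InnerProductGeometry.angle_comm (deriv g y)] at h3
  linarith

theorem Loop.totalCurvature_lt_top {γ : Loop} (h : γ.length ≠ ⊤) (hpos : 0 < γ.len)
    (hC : ContDiff ℝ 1 γ.arclengthParam)
    (hbv : LocallyBoundedVariationOn (deriv γ.arclengthParam) univ) : γ.totalCurvature < ⊤ := by
  set g := γ.arclengthParam with hgdef
  have hg : LipschitzWith 1 g := Loop.lipschitzWith_arclengthParam h hpos
  set τ := variationOnFromTo (deriv g) univ 0 with hτ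
  refine lt_of_le_of_lt (iSup_le fun P => ENNReal.ofReal_le_ofReal (?_ : _ ≤
    Real.pi * (2 * variationOnFromTo (deriv g) univ 0 (0 + γ.len)))) ENNReal.ofReal_lt_top
  set s : ℕ → ℝ := fun k => γ.arclength (P.t k) with hs
  have hgs : ∀ k, γ.lift (P.t k) = g (s k) := fun k => (Loop.arclengthParam_arclength h _).symm
  -- Nondegenerate edges have distinct endpoints, hence distinct arclength parameters.
  have hlt : ∀ k, s k < s (k + 1) := fun k => by
    refine lt_of_le_of_ne (Loop.monotone_arclength h (P.mono (Nat.le_succ k))) fun heq => ?_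
    apply P.edge_ne k
    rw [hgs, hgs, heq]
  have hper : ∀ k, τ (s (k + P.n)) = τ (s k) + τ (0 + γ.len) := fun k => by
    have : s (k + P.n) = s k + γ.len := by
      simp only [hs, P.periodic, Loop.arclength_add_one h]
    rw [this]
    exact variationOnFromTo_period hbv (periodic_deriv (Loop.arclengthParam_periodic h hpos)) 0 _
  calc P.totalCurvature
      ≤ ∑ k ∈ Finset.range P.n, Real.pi * (τ (s (k + 1 + 1)) - τ (s k)) := by
        refine Finset.sum_le_sum fun k _ => ?_
        simp only [Loop.InscribedPolygon.edge, hgs]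
        exact angle_sub_sub_le hg hbv (norm_deriv_eq_one hg hC
          (Loop.eVariationOn_arclengthParam_Icc h hpos) _) (hlt k) (hlt (k + 1))
    _ = Real.pi * (∑ k ∈ Finset.range P.n, (τ (s (k + 1)) - τ (s k)) +
          ∑ k ∈ Finset.range P.n, (τ (s (k + 1 + 1)) - τ (s (k + 1)))) := by
        rw [← Finset.mul_sum, ← Finset.sum_add_distrib]
        congr 1
        exact Finset.sum_congr rfl fun k _ => by ring
    -- Both sums telescope over one full period; the factor `2` appears because each arc adjoins two
    -- vertices.
    _ = Real.pi * (2 * τ (0 + γ.len)) := by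
        rw [Finset.sum_range_sub (fun k => τ (s k)), Finset.sum_range_sub (fun k => τ (s (k + 1)))]
        have h0 := hper 0
        have h1 := hper 1
        rw [zero_add] at h0
        rw [add_comm 1] at h1
        simp only [zero_add, h0, h1]
        ring

theorem Loop.totalCurvature_eq_zero_of_len_eq_zero {γ : Loop} (h : γ.length ≠ ⊤)
    (h0 : γ.len = 0) : γ.totalCurvature = 0 := by
  have : IsEmpty γ.InscribedPolygon :=
    ⟨fun P => P.edge_ne 0 (Loop.lift_eq_of_len_eq_zero h h0 _ _)⟩
  exact iSup_of_empty _

theorem Loop.contDiff_arclengthParam_of_len_eq_zero {γ : Loop} (h : γ.length ≠ ⊤)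
    (h0 : γ.len = 0) : ContDiff ℝ 1 γ.arclengthParam := by
  have : γ.arclengthParam = fun _ => γ.lift 0 :=
    funext fun s => Loop.lift_eq_of_len_eq_zero h h0 _ _
  rw [this]
  exact contDiff_const

end TotalCurvature

theorem ClosedCurve.variationalInequality {ι : Type*} [Fintype ι] {L : ClosedCurve ι}
    (hL : L.IsLink) {ε : ℝ} (hε : 0 < ε)
    (hcrit : ∀ ξ : ClosedCurve ι, L.IsSmoothField ξ → L.firstVariationLength ξ = -1 →
      L.firstVariationThickness ξ ≤ -ε) {i : ι} (h : (L i).length ≠ ⊤) (hpos : 0 < (L i).len) :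
    VariationalInequality (L i).arclengthParam (L i).len (L.others i) L.linkThickness ε := by
  intro Ξ hΞ hper hneg
  obtain ⟨hne, hstrut⟩ := exists_strut_of_integral_neg hL hε hcrit h hpos hΞ hper hneg
  exact ⟨hL.linkThickness_pos hne, hstrut⟩

end LinkRopelength

theorem mainTheorem4 {ι : Type*} [Fintype ι] (L : LinkRopelength.ClosedCurve ι)
    (hlink : L.IsLink) (hrect : L.IsRectifiable) (hcrit : L.IsStronglyCritical) :
    L.IsC1 ∧ L.IsFTC := by
  open LinkRopelength in
  obtain ⟨ε, hε, hcrit⟩ := hcrit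
  have key : ∀ i, ContDiff ℝ 1 (L i).arclengthParam ∧ (L i).totalCurvature < ⊤ := by
    intro i
    have h := hrect i
    -- A component of length zero is constant: its arclength is not onto `ℝ`, but it has no
    -- inscribed polygons with nondegenerate edges.
    rcases (L i).len_nonneg.eq_or_lt with h0 | hpos
    · exact ⟨Loop.contDiff_arclengthParam_of_len_eq_zero h h0.symm,
        by rw [Loop.totalCurvature_eq_zero_of_len_eq_zero h h0.symm]; exact ENNReal.zero_lt_top⟩
    · have hv := ClosedCurve.variationalInequality hlink hε hcrit h hpos
      have hg := Loop.lipschitzWith_arclengthParam h hpos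
      have hper := Loop.arclengthParam_periodic h hpos
      have hC := hv.contDiff_one hpos hε hg hper (L.isCompact_others i)
        fun σ y hy => ClosedCurve.linkThickness_le_dist_others h hpos σ hy
      exact ⟨hC, Loop.totalCurvature_lt_top h hpos hC
        (hv.locallyBoundedVariationOn_deriv hpos hε hg hper (hC.continuous_deriv le_rfl))⟩
  exact ⟨fun i => (key i).1, ENNReal.sum_lt_top.2 fun i _ => (key i).2⟩
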